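/- Let $\gamma:[0,\infty)\to[0,\infty)$ be a monotone increasing (nondecreasing) function with $\gamma(t)>0$ for $t>0$ and $\gamma(t)=O(t^2)$ as $t\to0^+$. Conventions. $\Pi$ is the open upper half plane and $\mathbb D$ the open unit disk. For $\varphi:\mathbb D\to\overline{\mathbb D}$ the Julia quotient is $J_\varphi(z)=\frac{\operatorname{dist}(\varphi(z),\partial\mathbb D)}{\operatorname{dist}(z,\partial\mathbb D)}=\frac{1-|\varphi(z)|}{1-|z|}$. For $\lambda:[0,\infty)\to[0,\infty)$ and $\tau\in\partial\mathbb D$ the $\lambda$-Stolz region at $\tau$ is $$S^\lambda_\tau=\Bigl\{z\in\mathbb D:\ \operatorname{dist}(z,\partial\mathbb D)\ge\lambda(c)\ \text{ and }\ \sqrt{|z-\tau|^2-\operatorname{dist}(z,\partial\mathbb D)^2}\le c\ \text{ for some } c>0\Bigr\}.$$ A function $\lambda:[0,\infty)\to[0,\infty)$ with $\lambda(t)=o(t)$ as $t\to0^+$ is a $\gamma$-augury if for some $C>0$ the function $t\lambda(Ct)$ is integrable on $[0,1)$ with respect to the measure $\frac{d\gamma(t)}{\gamma(t)^2}=-d\bigl(\tfrac1{\gamma}\bigr)(t)$,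 where $d$ denotes the distributional derivative (so at a jump of $\gamma$ the factor $\gamma(t)^2$ is read as $\gamma(t-)\gamma(t+)$). The Nevanlinna measure $\mu_f$ of an analytic $f:\Pi\to\overline\Pi$ is the weak limit (against continuous compactly supported functions) of the measures $\operatorname{Im}f(x+iy)\,dx$ on $\mathbb R$ as $y\to0^+$, and $f$ is $\gamma$-regular at $\sigma\in\mathbb R$ if for some $C>0$ the function $t\mapsto 1/\gamma(C|t-\sigma|)$ (equal to $\infty$ at $t=\sigma$) is $\mu_f$-integrable on a neighborhood of $\sigma$. An analytic $\varphi:\mathbb D\to\overline{\mathbb D}$ is transform $\gamma$-regular at $\tau\in\partial\mathbb D$ if there are conformal bijections $\chi:\Pi\to\mathbb D$ and $\psi:\mathbb D\to\Pi$ and a point $\sigma\in\mathbb R$ with $\chi(w)\to\tau$ as $w\to\sigma$ such that $\psi\circ\varphi\circ\chi$ is $\gamma$-regular at $\sigma$ (if $\varphi$ is a unimodular constant, $\psi$ is required to extend continuously to that constant, and the extension is used). Statement. Suppose that $\sqrt{\gamma(t)}$ is a $\gamma$-augury. Let $\varphi:\mathbb D\to\overline{\mathbb D}$ be analytic and $\tau\in\partial\mathbb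 D$. The following are equivalent: 1. $\varphi$ is transform $\gamma$-regular at $\tau$; 2. there are $C,D>0$ such that $J_\varphi(z)$ is bounded on $S_\tau^{\sqrt{D\gamma(Ct)}}$ as $z\to\tau$, that is, bounded on the intersection of this region with some neighborhood of $\tau$; 3. there are $C,D>0$ such that $$\limsup_{t\to0,\ t\ne0}J_\varphi\bigl(\tau e^{-D\gamma(C|t|)+it}\bigr)<\infty.$$ -/

import Mathlib

open Set Filter Topology MeasureTheory Asymptotics

noncomputable section

/-- The open upper half plane `Π`. -/
def upperPlane : Set ℂ := {z : ℂ | 0 < z.im}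

/-- The open unit disk `𝔻`. -/
def unitDisk : Set ℂ := Metric.ball (0 : ℂ) 1

/-- The Julia quotient `J_f(z) = dist(f(z), ∂Ω) / dist(z, ∂D)` of a map `f : D → closure Ω`. -/
def juliaQuotient (D Ω : Set ℂ) (f : ℂ → ℂ) (z : ℂ) : ℝ :=
  Metric.infDist (f z) (frontier Ω) / Metric.infDist z (frontier D)

/-- The `lam`-Stolz region of the domain `D` at the boundary point `τ`. -/
def stolzRegion (D : Set ℂ) (lam : ℝ → ℝ) (τ : ℂ) : Set ℂ :=
  {z : ℂ | z ∈ D ∧ ∃ c : ℝ, 0 < c ∧ lam c ≤ Metric.infDist z (frontier D) ∧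
    √(dist z τ ^ 2 - Metric.infDist z (frontier D) ^ 2) ≤ c}

/-- `μ` is the Nevanlinna measure of `f : Π → closure Π`: the locally finite Borel measure on `ℝ`
that is the weak limit, as `y → 0+`, of the measures `Im f(x + iy) dx`.
These measures are in general infinite, so the test functions are the continuous functions of
compact support. -/
def IsNevanlinnaMeasure (f : ℂ → ℂ) (μ : Measure ℝ) : Prop :=
  IsLocallyFiniteMeasure μ ∧
  ∀ g : ℝ → ℝ, Continuous g → HasCompactSupport g →
    Tendsto (fun y : ℝ => ∫ x : ℝ, g x * (f (x + y * Complex.I)).im) (𝓝[>] 0)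
      (𝓝 (∫ x : ℝ, g x ∂μ))

/-- `γ`-regularity at `σ ∈ ℝ` of an analytic function `f : Π → closure Π`: for some `C > 0` the
function `1 / γ(C|t - σ|)`, with value `∞` where `γ(C|t - σ|) = 0`, is integrable on a
neighbourhood of `σ` with respect to the Nevanlinna measure. -/
def GammaRegularAt (γ : ℝ → ℝ) (f : ℂ → ℂ) (σ : ℝ) : Prop :=
  ∃ μ : Measure ℝ, IsNevanlinnaMeasure f μ ∧
    ∃ C : ℝ, 0 < C ∧ ∃ δ : ℝ, 0 < δ ∧
      ∫⁻ t in Ioo (σ - δ) (σ + δ), (ENNReal.ofReal (γ (C * |t - σ|)))⁻¹ ∂μ < ⊤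

/-- `h` maps the open set `U` conformally onto `V`. -/
def IsConformalOnto (h : ℂ → ℂ) (U V : Set ℂ) : Prop :=
  DifferentiableOn ℂ h U ∧ BijOn h U V

/-- Transform `γ`-regularity at `τ ∈ ∂D` of a map `f : D → closure Ω`: there are conformal maps
`χ` of `Π` onto `D`, taking a real boundary point `σ` to `τ`, and `ψ` of `Ω` onto `Π`, such that
`ψ ∘ f ∘ χ` is `γ`-regular at `σ`.
As `f` may take values in `∂Ω`, the map `ψ` has to extend continuously to the values of `f`, and
there `ψ` denotes that extension; this condition is void when `f` maps `D` into `Ω`. -/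
def TransformGammaRegularAt (D Ω : Set ℂ) (γ : ℝ → ℝ) (f : ℂ → ℂ) (τ : ℂ) : Prop :=
  ∃ (ψ χ : ℂ → ℂ) (σ : ℝ),
    IsConformalOnto χ upperPlane D ∧
    Tendsto χ (𝓝[upperPlane] (σ : ℂ)) (𝓝 τ) ∧
    IsConformalOnto ψ Ω upperPlane ∧
    (∀ z ∈ D, ContinuousWithinAt ψ Ω (f z)) ∧
    GammaRegularAt γ (fun w => ψ (f (χ w))) σ

theorem monotone_extend {γ : ℝ → ℝ} (hγ : MonotoneOn γ (Ici 0)) :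
    Monotone (fun t : ℝ => γ (max t 0)) := fun a b hab =>
  hγ (le_max_right a 0) (le_max_right b 0) (max_le_max_right 0 hab)

/-- The distributional derivative `dγ` of a function `γ` that is monotone on `[0, ∞)`, as a
measure: the Lebesgue-Stieltjes measure of `γ`, extended to negative numbers as a constant. -/
def derivMeasure (γ : ℝ → ℝ) (hγ : MonotoneOn γ (Ici 0)) : Measure ℝ :=
  (monotone_extend hγ).stieltjesFunction.measure

/-- `lam` is a `γ`-augury: `lam ≥ 0`, `lam(t) = o(t)` as `t → 0`, and for some `C > 0` the
function `t lam(Ct)` is integrable on `[0, 1)` with respect to `dγ / γ²`.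
The measure `dγ / γ²` is `-d(1/γ)`. Thus, at a jump of `γ`, where the value of `γ²` with respect
to `dγ` has to be specified, it is `γ(t-) γ(t+)`; the atom of `-d(1/γ)` at `t` is
`1/γ(t-) - 1/γ(t+) = (γ(t+) - γ(t-)) / (γ(t-) γ(t+))`. Where `γ` is continuous,
`γ(t-) γ(t+) = γ(t)²`. -/
def IsAugury (γ : ℝ → ℝ) (hγ : MonotoneOn γ (Ici 0)) (lam : ℝ → ℝ) : Prop :=
  (∀ t : ℝ, 0 ≤ t → 0 ≤ lam t) ∧
  (lam =o[𝓝[>] 0] fun t : ℝ => t) ∧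
  ∃ C : ℝ, 0 < C ∧
    IntegrableOn
      (fun t : ℝ => t * lam (C * t) / (Function.leftLim γ t * Function.rightLim γ t))
      (Ico 0 1) (derivMeasure γ hγ)

end

open scoped ComplexConjugate

/-! Carried to the half plane, `φ` becomes a function `f` with Im f(w) = b Im w + ∫ Im w / (π|t -
w|²) dμ(t), where μ is the Nevanlinna measure (`exists_isNevanlinnaMeasure`). The Julia quotient is
compared with Im f / Im w, so the theorem relates the growth of that ratio near σ to the mass of μ
near σ.

From 1 to 2: wherever 1/|t - w|² is dominated by 1/γ(C|t - σ|), integrability of the latter bounds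
Im f / Im w (`GammaRegularAt.exists_im_le`). The Stolz region of √γ is such a set, because there
dist² dominates γ (`kernel_bound_of_stolz`). A Hopf type bound returns to the disk.

From 2 to 3: this is the only use of the augury. Integrating it over the stretch where γ doubles
gives a√(γ(Ca)) ≤ Mγ(a). With γ(t) = o(t²) this bootstraps to γ(κa) ≤ Kγ(a)²
(`IsAugury.exists_le_sq`). Hence a curve at height γ, suitably rescaled, lies inside the Stolz
region of √γ.

From 3 to 1: by Schwarz–Pick the values of `φ` on the curve avoid a neighbourhood of some boundary
point (`exists_pole`); ψ gets its pole there. Then Im f ≤ Q Im w on a curve of height y ≈ γ, and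
testing the Poisson integral at one point gives mass O(y²) to an interval of length y. About r/y
such intervals cover a dyadic block at distance r, so the block has mass O(ry), and 1/y integrates
to O(r) over it. The sum over r = 2⁻ⁿ converges (`exists_lintegral_Ioo_lt_top`). -/

/-! ### The unit disk and the Schwarz–Pick lemma -/

theorem frontier_unitDisk : frontier unitDisk = Metric.sphere (0 : ℂ) 1 :=
  frontier_ball (0 : ℂ) one_ne_zero

theorem closure_unitDisk : closure unitDisk = Metric.closedBall (0 : ℂ) 1 :=
  closure_ball (0 : ℂ) one_ne_zero

theorem mem_unitDisk {z : ℂ} : z ∈ unitDisk ↔ ‖z‖ < 1 := by simp [unitDisk]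

/-- The distance of a point of the closed unit disk to the unit circle. -/
theorem infDist_frontier_unitDisk {z : ℂ} (hz : ‖z‖ ≤ 1) :
    Metric.infDist z (frontier unitDisk) = 1 - ‖z‖ := by
  rw [frontier_unitDisk]
  have hne : (Metric.sphere (0 : ℂ) 1).Nonempty := ⟨1, by simp⟩
  apply le_antisymm
  · obtain ⟨u, hu, hzu⟩ : ∃ u : ℂ, ‖u‖ = 1 ∧ z = ‖z‖ * u := by
      by_cases h : z = 0
      · exact ⟨1, by simp, by simp [h]⟩
      · have h' : (‖z‖ : ℂ) ≠ 0 := by simpa using h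
        exact ⟨z / ‖z‖, by simp [h], by field_simp⟩
    refine (Metric.infDist_le_dist_of_mem (y := u) (by simpa using hu)).trans ?_
    rw [dist_eq_norm]
    have : z - u = ((‖z‖ - 1 : ℝ) : ℂ) * u := by
      push_cast
      linear_combination hzu
    rw [this, norm_mul, hu, mul_one, Complex.norm_real, Real.norm_eq_abs, abs_of_nonpos] <;>
      linarith
  · refine (Metric.le_infDist hne).2 fun u hu => ?_
    rw [dist_comm, dist_eq_norm]
    have : ‖u‖ = 1 := by simpa using hu
    linarith [norm_sub_norm_le u z]

/-- An analytic self-map of the disk, with values in the closed disk, maps into the open disk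
or is a unimodular constant. -/
theorem mapsTo_unitDisk_or_const {φ : ℂ → ℂ} (hφ : DifferentiableOn ℂ φ unitDisk)
    (hm : MapsTo φ unitDisk (closure unitDisk)) :
    MapsTo φ unitDisk unitDisk ∨ ∃ c : ℂ, ‖c‖ = 1 ∧ ∀ z ∈ unitDisk, φ z = c := by
  have hle : ∀ z ∈ unitDisk, ‖φ z‖ ≤ 1 := fun z hz => by
    simpa [closure_unitDisk] using hm hz
  by_cases h : ∃ p ∈ unitDisk, ‖φ p‖ = 1
  · obtain ⟨p, hp, hp1⟩ := h
    refine Or.inr ⟨φ p, hp1, fun z hz => ?_⟩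
    exact Complex.eqOn_of_isPreconnected_of_isMaxOn_norm
      (convex_ball (0 : ℂ) 1).isPreconnected Metric.isOpen_ball hφ hp
      (fun w hw => by simpa [hp1] using hle w hw) hz
  · push Not at h
    exact Or.inl fun z hz => mem_unitDisk.2 (lt_of_le_of_ne (hle z hz) (h z hz))

/-- The identity behind the disk automorphisms. -/
theorem normSq_one_sub_conj_mul (a b : ℂ) :
    ‖1 - conj a * b‖ ^ 2 - ‖b - a‖ ^ 2 = (1 - ‖a‖ ^ 2) * (1 - ‖b‖ ^ 2) := by
  simp only [← Complex.normSq_eq_norm_sq, Complex.normSq_apply]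
  simp
  ring

theorem one_sub_conj_mul_ne_zero {a b : ℂ} (ha : ‖a‖ < 1) (hb : ‖b‖ ≤ 1) :
    1 - conj a * b ≠ 0 := by
  intro h
  have h1 : conj a * b = 1 := by linear_combination -h
  have h2 : ‖a‖ * ‖b‖ = 1 := by simpa using congrArg norm h1
  nlinarith [norm_nonneg a, norm_nonneg b]

/-- The disk automorphism interchanging `a` and `0`, up to sign. -/
noncomputable def diskShift (a z : ℂ) : ℂ := (z - a) / (1 - conj a * z)

theorem one_sub_norm_diskShift {a z : ℂ} (ha : ‖a‖ < 1) (hz : ‖z‖ ≤ 1) :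
    1 - ‖diskShift a z‖ ^ 2 = (1 - ‖a‖ ^ 2) * (1 - ‖z‖ ^ 2) / ‖1 - conj a * z‖ ^ 2 := by
  have h : ‖1 - conj a * z‖ ≠ 0 := norm_ne_zero_iff.2 (one_sub_conj_mul_ne_zero ha hz)
  rw [diskShift, norm_div, ← normSq_one_sub_conj_mul, div_pow, eq_div_iff (pow_ne_zero 2 h),
    sub_mul, div_mul_cancel₀ _ (pow_ne_zero 2 h), one_mul]

theorem diskShift_mem {a z : ℂ} (ha : ‖a‖ < 1) (hz : ‖z‖ < 1) : ‖diskShift a z‖ < 1 := by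
  have h : 0 < ‖1 - conj a * z‖ := norm_pos_iff.2 (one_sub_conj_mul_ne_zero ha hz.le)
  have h1 := one_sub_norm_diskShift ha hz.le
  have : 0 < 1 - ‖diskShift a z‖ ^ 2 := by
    rw [h1]
    have : 0 < 1 - ‖a‖ ^ 2 := by nlinarith [norm_nonneg a]
    have : 0 < 1 - ‖z‖ ^ 2 := by nlinarith [norm_nonneg z]
    positivity
  nlinarith [norm_nonneg (diskShift a z)]

theorem differentiableOn_diskShift {a : ℂ} (ha : ‖a‖ < 1) :
    DifferentiableOn ℂ (diskShift a) unitDisk := by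
  unfold diskShift
  refine DifferentiableOn.div (by fun_prop) (by fun_prop) fun z hz => ?_
  exact one_sub_conj_mul_ne_zero ha (mem_unitDisk.1 hz).le

theorem diskShift_neg_diskShift {a z : ℂ} (ha : ‖a‖ < 1) (hz : ‖z‖ < 1) :
    diskShift (-a) (diskShift a z) = z := by
  have h1 := one_sub_conj_mul_ne_zero ha hz.le
  have h2 := one_sub_conj_mul_ne_zero ha ha.le
  have e1 : diskShift a z + a = z * (1 - conj a * a) / (1 - conj a * z) := by
    rw [diskShift, eq_div_iff h1, add_mul, div_mul_cancel₀ _ h1]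
    ring
  have e2 : 1 + conj a * diskShift a z = (1 - conj a * a) / (1 - conj a * z) := by
    rw [diskShift, eq_div_iff h1, add_mul, mul_assoc, div_mul_cancel₀ _ h1]
    ring
  rw [diskShift, map_neg, sub_neg_eq_add, neg_mul, sub_neg_eq_add, e1, e2,
    div_div_div_cancel_right₀ h1, mul_div_cancel_right₀ _ h2]

/-- The **Schwarz–Pick lemma**. -/
theorem schwarz_pick {φ : ℂ → ℂ} (hφ : DifferentiableOn ℂ φ unitDisk)
    (hm : MapsTo φ unitDisk unitDisk) {z z' : ℂ} (hz : z ∈ unitDisk) (hz' : z' ∈ unitDisk) :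
    ‖1 - conj (φ z') * φ z‖ ^ 2 * ((1 - ‖z'‖ ^ 2) * (1 - ‖z‖ ^ 2)) ≤
      ‖1 - conj z' * z‖ ^ 2 * ((1 - ‖φ z'‖ ^ 2) * (1 - ‖φ z‖ ^ 2)) := by
  have hz1 := mem_unitDisk.1 hz
  have hz1' := mem_unitDisk.1 hz'
  have hp := mem_unitDisk.1 (hm hz)
  have hp' := mem_unitDisk.1 (hm hz')
  have hn : ‖-z'‖ < 1 := by simpa using hz1'
  -- Automorphisms before and after `φ` make `0` a fixed point, which reduces the claim to the
  -- Schwarz lemma.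
  set h : ℂ → ℂ := fun ζ => diskShift (φ z') (φ (diskShift (-z') ζ)) with hh
  have hmaps : MapsTo (diskShift (-z')) unitDisk unitDisk := fun ζ hζ =>
    mem_unitDisk.2 (diskShift_mem hn (mem_unitDisk.1 hζ))
  have hd : DifferentiableOn ℂ h unitDisk :=
    (differentiableOn_diskShift hp').comp
      (hφ.comp (differentiableOn_diskShift hn) hmaps) (hm.comp hmaps)
  have h0 : h 0 = 0 := by simp [hh, diskShift]
  have hmh : MapsTo h unitDisk (Metric.closedBall 0 1) := fun ζ hζ => by
    simpa using (diskShift_mem hp' (mem_unitDisk.1 (hm (hmaps hζ)))).le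
  have key := Complex.norm_le_norm_of_mapsTo_ball hd hmh h0 (z := diskShift z' z)
    (diskShift_mem hz1' hz1)
  have e : h (diskShift z' z) = diskShift (φ z') (φ z) := by
    simp [hh, diskShift_neg_diskShift hz1' hz1]
  rw [e] at key
  have k2 : 1 - ‖diskShift z' z‖ ^ 2 ≤ 1 - ‖diskShift (φ z') (φ z)‖ ^ 2 := by
    gcongr
  rw [one_sub_norm_diskShift hz1' hz1.le, one_sub_norm_diskShift hp' hp.le] at k2
  have p1 : 0 < ‖1 - conj z' * z‖ := norm_pos_iff.2 (one_sub_conj_mul_ne_zero hz1' hz1.le)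
  have p2 : 0 < ‖1 - conj (φ z') * φ z‖ :=
    norm_pos_iff.2 (one_sub_conj_mul_ne_zero hp' hp.le)
  rw [div_le_div_iff₀ (by positivity) (by positivity)] at k2
  linarith

/-! ### Conformal maps between the disk and the half plane -/

/-- The inverse of a conformal map is conformal. -/
theorem IsConformalOnto.exists_inverse {h : ℂ → ℂ} {U V : Set ℂ} (hU : IsOpen U)
    (hh : IsConformalOnto h U V) :
    ∃ k : ℂ → ℂ, IsConformalOnto k V U ∧ (∀ z ∈ U, k (h z) = z) ∧ ∀ w ∈ V, h (k w) = w := by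
  obtain ⟨hd, hb⟩ := hh
  have hinv : InvOn (Function.invFunOn h U) h U V := hb.invOn_invFunOn
  set k := Function.invFunOn h U
  have hkm : MapsTo k V U := hb.surjOn.mapsTo_invFunOn
  have ha : ∀ z ∈ U, AnalyticAt ℂ h z := fun z hz => hd.analyticAt (hU.mem_nhds hz)
  -- `h` is open at each point of `U`
  have hopen : ∀ z ∈ U, 𝓝 (h z) ≤ map h (𝓝 z) := fun z hz => by
    rcases (ha z hz).eventually_constant_or_nhds_le_map_nhds with hc | hc
    · exfalso
      obtain ⟨w, ⟨hw, hwU⟩, hne⟩ :=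
        (((hc.and (hU.mem_nhds hz)).filter_mono (nhdsWithin_le_nhds (s := {z}ᶜ))).and
          self_mem_nhdsWithin).exists
      exact hne (hb.injOn hwU hz hw)
    · exact hc
  have hcont : ∀ z ∈ U, Tendsto k (𝓝 (h z)) (𝓝 z) := fun z hz => by
    refine (tendsto_map'_iff.2 ?_).mono_left (hopen z hz)
    refine Tendsto.congr' ?_ (tendsto_id (α := ℂ))
    filter_upwards [hU.mem_nhds hz] with w hw using (hinv.1 hw).symm
  have hkh : ∀ z ∈ U, k (h z) = z := fun z hz => hinv.1 hz
  have hVnhds : ∀ z ∈ U, V ∈ 𝓝 (h z) := fun z hz => by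
    refine hopen z hz (mem_map.2 ?_)
    filter_upwards [hU.mem_nhds hz] with w hw using hb.mapsTo hw
  have hev : ∀ z ∈ U, ∀ᶠ w in 𝓝 (h z), h (k w) = w := fun z hz => by
    filter_upwards [hVnhds z hz] with w hw using hinv.2 hw
  have hreg : ∀ z ∈ U, deriv h z ≠ 0 → DifferentiableAt ℂ k (h z) := fun z hz hz0 => by
    have hder : HasDerivAt h (deriv h z) (k (h z)) := by
      rw [hkh z hz]; exact (ha z hz).differentiableAt.hasDerivAt
    refine (HasDerivAt.of_local_left_inverse ?_ hder hz0 (hev z hz)).differentiableAt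
    rw [ContinuousAt, hkh z hz]; exact hcont z hz
  -- Zeros of the derivative of an analytic function are isolated unless it vanishes on a whole
  -- disk, which injectivity excludes. At an isolated zero the inverse is continuous and
  -- differentiable nearby, so the singularity is removable.
  have hall : ∀ z ∈ U, DifferentiableAt ℂ k (h z) := fun z hz => by
    rcases (ha z hz).deriv.eventually_eq_zero_or_eventually_ne_zero with h0 | h0
    · exfalso
      obtain ⟨r, hr, hball⟩ := Metric.eventually_nhds_iff_ball.1 (h0.and (hU.mem_nhds hz))
      have hc : ∀ w ∈ Metric.ball z r, h w = h z := fun w hw => by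
        refine (convex_ball z r).is_const_of_fderivWithin_eq_zero (𝕜 := ℂ) (f := h)
          (fun x hx => (ha x (hball x hx).2).differentiableAt.differentiableWithinAt)
          (fun x hx => ?_) hw (Metric.mem_ball_self hr)
        rw [fderivWithin_of_isOpen Metric.isOpen_ball hx]
        ext
        simpa using (hball x hx).1
      have hw : z + (r / 2 : ℝ) ∈ Metric.ball z r := by
        simp [abs_of_pos hr]
        linarith
      have := hb.injOn (hball _ hw).2 hz (hc _ hw)
      have h3 : ((r / 2 : ℝ) : ℂ) = 0 := by linear_combination this
      have h4 : r / 2 = 0 := by exact_mod_cast h3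
      linarith
    · refine (Complex.analyticAt_of_differentiable_on_punctured_nhds_of_continuousAt ?_
        ?_).differentiableAt
      · have t : Tendsto k (𝓝[≠] (h z)) (𝓝[≠] z) := by
          refine tendsto_nhdsWithin_iff.2 ⟨(hcont z hz).mono_left nhdsWithin_le_nhds, ?_⟩
          filter_upwards [self_mem_nhdsWithin,
            (hev z hz).filter_mono nhdsWithin_le_nhds] with w hw hw2 hw3
          exact hw (by rw [← hw2, hw3]; rfl)
        filter_upwards [t h0, (hev z hz).filter_mono nhdsWithin_le_nhds,
          nhdsWithin_le_nhds (hVnhds z hz)] with w hw hw2 hw3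
        rw [← hw2]
        exact hreg _ (hkm hw3) hw
      · rw [ContinuousAt, hkh z hz]; exact hcont z hz
  refine ⟨k, ⟨fun w hw => ?_, ?_⟩, hkh, fun w hw => hinv.2 hw⟩
  · obtain ⟨z, hz, rfl⟩ := hb.surjOn hw
    exact (hall z hz).differentiableWithinAt
  · exact hinv.symm.bijOn hkm hb.mapsTo

/-- The conformal maps of the disk onto itself fixing `0` are the rotations. -/
theorem IsConformalOnto.eq_rotation {h : ℂ → ℂ} (hh : IsConformalOnto h unitDisk unitDisk)
    (h0 : h 0 = 0) : ∃ c : ℂ, ‖c‖ = 1 ∧ ∀ z ∈ unitDisk, h z = c * z := by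
  obtain ⟨k, hk, hkh, -⟩ := hh.exists_inverse Metric.isOpen_ball
  have z0 : (0 : ℂ) ∈ unitDisk := by simp [unitDisk]
  have k0 : k 0 = 0 := by simpa [h0] using hkh 0 z0
  have m : ∀ {g : ℂ → ℂ}, MapsTo g unitDisk unitDisk → MapsTo g unitDisk (Metric.closedBall 0 1) :=
    fun hg z hz => Metric.ball_subset_closedBall (hg hz)
  set p : ℂ := 1 / 2
  have hp : p ∈ unitDisk := by simp [p, unitDisk]; norm_num
  -- The Schwarz lemma for the map and for its inverse forces equality at one nonzero point, which
  -- is enough for the rigidity case.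
  have e1 := Complex.norm_le_norm_of_mapsTo_ball hh.1 (m hh.2.mapsTo) h0 (mem_unitDisk.1 hp)
  have e2 := Complex.norm_le_norm_of_mapsTo_ball hk.1 (m hk.2.mapsTo) k0
    (mem_unitDisk.1 (hh.2.mapsTo hp))
  rw [hkh p hp] at e2
  have e3 : ‖h p‖ = ‖p‖ := le_antisymm e1 e2
  have hp0 : p ≠ 0 := by simp [p]
  obtain ⟨c, hc, hc2⟩ := Complex.affine_of_mapsTo_ball_of_exists_norm_dslope_eq_div' (R₁ := 1)
    (R₂ := 1) (c := 0) hh.1 (by rw [h0]; exact m hh.2.mapsTo)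
    ⟨p, hp, by rw [dslope_of_ne _ hp0, slope_def_field, h0]; simp [e3, hp0]⟩
  refine ⟨c, by simpa using hc, fun z hz => ?_⟩
  have := hc2 hz
  simp only [h0, sub_zero, zero_add, smul_eq_mul] at this
  rw [this, mul_comm]

theorem IsConformalOnto.comp {g h : ℂ → ℂ} {U V W : Set ℂ} (hg : IsConformalOnto g V W)
    (hh : IsConformalOnto h U V) : IsConformalOnto (fun z => g (h z)) U W :=
  ⟨hg.1.comp hh.1 hh.2.mapsTo, hg.2.comp hh.2⟩

theorem sub_conj_ne_zero {a w : ℂ} (ha : 0 < a.im) (hw : 0 ≤ w.im) : w - conj a ≠ 0 := by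
  intro h
  have := congrArg Complex.im h
  simp at this
  linarith

theorem im_le_norm_sub_conj {a w : ℂ} (hw : 0 ≤ w.im) : a.im ≤ ‖w - conj a‖ := by
  refine le_trans ?_ (Complex.abs_im_le_norm _)
  refine le_trans ?_ (le_abs_self _)
  simpa

/-- The conformal map of the upper half plane onto the disk taking `a` to `0`. -/
noncomputable def cayleyAt (a w : ℂ) : ℂ := (w - a) / (w - conj a)

theorem one_sub_norm_cayleyAt {a w : ℂ} (ha : 0 < a.im) (hw : 0 ≤ w.im) :
    1 - ‖cayleyAt a w‖ ^ 2 = 4 * a.im * w.im / ‖w - conj a‖ ^ 2 := by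
  have h : ‖w - conj a‖ ≠ 0 := norm_ne_zero_iff.2 (sub_conj_ne_zero ha hw)
  rw [cayleyAt, norm_div, div_pow, eq_div_iff (pow_ne_zero 2 h),
    sub_mul, div_mul_cancel₀ _ (pow_ne_zero 2 h), one_mul]
  simp only [← Complex.normSq_eq_norm_sq, Complex.normSq_apply]
  simp
  ring

theorem norm_cayleyAt_lt_one {a w : ℂ} (ha : 0 < a.im) (hw : 0 < w.im) : ‖cayleyAt a w‖ < 1 := by
  have h : 0 < ‖w - conj a‖ := norm_pos_iff.2 (sub_conj_ne_zero ha hw.le)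
  have h1 := one_sub_norm_cayleyAt ha hw.le
  have : 0 < 1 - ‖cayleyAt a w‖ ^ 2 := by
    rw [h1]; positivity
  nlinarith [norm_nonneg (cayleyAt a w)]

/-- The inverse of `cayleyAt a`. -/
noncomputable def cayleyInv (a z : ℂ) : ℂ := (a - conj a * z) / (1 - z)

theorem one_sub_ne_zero_of_norm_lt {z : ℂ} (hz : ‖z‖ < 1) : 1 - z ≠ 0 := by
  intro h
  have : z = 1 := by linear_combination -h
  simp [this] at hz

theorem im_cayleyInv {a z : ℂ} (hz : z ≠ 1) :
    (cayleyInv a z).im = a.im * (1 - ‖z‖ ^ 2) / ‖1 - z‖ ^ 2 := by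
  have h1 : 1 - z ≠ 0 := sub_ne_zero.2 hz.symm
  have h : Complex.normSq (1 - z) ≠ 0 := by simpa using h1
  rw [cayleyInv, Complex.div_im, ← Complex.normSq_eq_norm_sq, ← Complex.normSq_eq_norm_sq]
  rw [← sub_div]
  congr 1
  simp [Complex.normSq_apply]
  ring

theorem im_cayleyInv_pos {a z : ℂ} (ha : 0 < a.im) (hz : ‖z‖ < 1) : 0 < (cayleyInv a z).im := by
  have h1 := one_sub_ne_zero_of_norm_lt hz
  rw [im_cayleyInv (by rintro rfl; simp at h1)]
  have : 0 < ‖1 - z‖ := norm_pos_iff.2 h1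
  have : 0 < 1 - ‖z‖ ^ 2 := by nlinarith [norm_nonneg z]
  positivity

theorem cayleyInv_cayleyAt {a w : ℂ} (ha : 0 < a.im) (hw : 0 ≤ w.im) :
    cayleyInv a (cayleyAt a w) = w := by
  have h := sub_conj_ne_zero ha hw
  have h2 := sub_conj_ne_zero ha ha.le
  have e1 : a - conj a * cayleyAt a w = w * (a - conj a) / (w - conj a) := by
    rw [cayleyAt, eq_div_iff h, sub_mul, mul_assoc, div_mul_cancel₀ _ h]
    ring
  have e2 : 1 - cayleyAt a w = (a - conj a) / (w - conj a) := by
    rw [cayleyAt, eq_div_iff h, sub_mul, div_mul_cancel₀ _ h]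
    ring
  rw [cayleyInv, e1, e2, div_div_div_cancel_right₀ h, mul_div_cancel_right₀ _ h2]

theorem cayleyAt_cayleyInv {a z : ℂ} (ha : 0 < a.im) (hz : z ≠ 1) :
    cayleyAt a (cayleyInv a z) = z := by
  have h : 1 - z ≠ 0 := sub_ne_zero.2 hz.symm
  have h2 := sub_conj_ne_zero ha ha.le
  have e1 : cayleyInv a z - a = z * (a - conj a) / (1 - z) := by
    rw [cayleyInv, eq_div_iff h, sub_mul, div_mul_cancel₀ _ h]
    ring
  have e2 : cayleyInv a z - conj a = (a - conj a) / (1 - z) := by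
    rw [cayleyInv, eq_div_iff h, sub_mul, div_mul_cancel₀ _ h]
    ring
  rw [cayleyAt, e1, e2, div_div_div_cancel_right₀ h, mul_div_cancel_right₀ _ h2]

theorem isConformalOnto_cayleyAt {a : ℂ} (ha : 0 < a.im) :
    IsConformalOnto (cayleyAt a) upperPlane unitDisk := by
  refine ⟨?_, ?_⟩
  · unfold cayleyAt
    refine DifferentiableOn.div (by fun_prop) (by fun_prop) fun w hw => ?_
    exact sub_conj_ne_zero ha (le_of_lt hw)
  · refine InvOn.bijOn (f' := cayleyInv a) ⟨fun w hw => cayleyInv_cayleyAt ha (le_of_lt hw),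
      fun z hz => cayleyAt_cayleyInv ha ?_⟩ (fun w hw => mem_unitDisk.2 (norm_cayleyAt_lt_one ha hw))
      (fun z hz => im_cayleyInv_pos ha (mem_unitDisk.1 hz))
    rintro rfl
    simp [mem_unitDisk] at hz

theorem isConformalOnto_cayleyInv {a : ℂ} (ha : 0 < a.im) :
    IsConformalOnto (cayleyInv a) unitDisk upperPlane := by
  refine ⟨?_, ?_⟩
  · unfold cayleyInv
    refine DifferentiableOn.div (by fun_prop) (by fun_prop) fun w hw => ?_
    exact one_sub_ne_zero_of_norm_lt (mem_unitDisk.1 hw)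
  · refine InvOn.bijOn (f' := cayleyAt a) ⟨fun z hz => cayleyAt_cayleyInv ha ?_,
      fun w hw => cayleyInv_cayleyAt ha (le_of_lt hw)⟩
      (fun z hz => im_cayleyInv_pos ha (mem_unitDisk.1 hz))
      (fun w hw => mem_unitDisk.2 (norm_cayleyAt_lt_one ha hw))
    rintro rfl
    simp [mem_unitDisk] at hz

/-- The conformal maps of the half plane onto the disk are the rotated Cayley transforms. -/
theorem IsConformalOnto.eq_cayleyAt {χ : ℂ → ℂ} (hχ : IsConformalOnto χ upperPlane unitDisk) :
    ∃ a c : ℂ, 0 < a.im ∧ ‖c‖ = 1 ∧ ∀ w ∈ upperPlane, χ w = c * cayleyAt a w := by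
  obtain ⟨a, ha, ha0⟩ := hχ.2.surjOn (show (0 : ℂ) ∈ unitDisk by simp [unitDisk])
  have hr : IsConformalOnto (fun z => χ (cayleyInv a z)) unitDisk unitDisk :=
    hχ.comp (isConformalOnto_cayleyInv ha)
  obtain ⟨c, hc, hcz⟩ := hr.eq_rotation (by simpa [cayleyInv] using ha0)
  refine ⟨a, c, ha, hc, fun w hw => ?_⟩
  rw [← hcz _ (mem_unitDisk.2 (norm_cayleyAt_lt_one ha hw)), cayleyInv_cayleyAt ha (le_of_lt hw)]

/-- A Hopf type bound for analytic maps of the disk into the half plane. -/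
theorem one_sub_norm_le_im {ψ : ℂ → ℂ} (hψ : DifferentiableOn ℂ ψ unitDisk)
    (hm : MapsTo ψ unitDisk upperPlane) {v : ℂ} (hv : v ∈ unitDisk) :
    (ψ 0).im / 4 * (1 - ‖v‖) ≤ (ψ v).im := by
  have h0 : 0 < (ψ 0).im := hm (show (0 : ℂ) ∈ unitDisk by simp [unitDisk])
  have hv0 : 0 < (ψ v).im := hm hv
  set p := ψ 0
  have hv1 := mem_unitDisk.1 hv
  -- Centring the Cayley transform at the value of `ψ` at `0` makes the composite fix `0`. The
  -- Schwarz lemma then compares the two distances to the circle.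
  have hd : DifferentiableOn ℂ (fun z => cayleyAt p (ψ z)) unitDisk :=
    (isConformalOnto_cayleyAt h0).1.comp hψ hm
  have hmh : MapsTo (fun z => cayleyAt p (ψ z)) unitDisk (Metric.closedBall 0 1) := fun z hz => by
    simpa using (norm_cayleyAt_lt_one h0 (hm hz)).le
  have key := Complex.norm_le_norm_of_mapsTo_ball hd hmh (by simp [cayleyAt, p]) hv1
  have k2 : 1 - ‖v‖ ^ 2 ≤ 1 - ‖cayleyAt p (ψ v)‖ ^ 2 := by gcongr
  rw [one_sub_norm_cayleyAt h0 hv0.le] at k2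
  have h1 := im_le_norm_sub_conj (a := p) hv0.le
  have hpos : 0 < ‖ψ v - conj p‖ := h0.trans_le h1
  rw [le_div_iff₀ (by positivity)] at k2
  have h3 : p.im ^ 2 * (1 - ‖v‖) ≤ 4 * p.im * (ψ v).im := by
    refine le_trans ?_ k2
    have : p.im ^ 2 ≤ ‖ψ v - conj p‖ ^ 2 := by gcongr
    have : 1 - ‖v‖ ≤ 1 - ‖v‖ ^ 2 := by nlinarith [norm_nonneg v]
    have : 0 ≤ 1 - ‖v‖ ^ 2 := by linarith
    rw [mul_comm]
    gcongr
  nlinarith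

/-! ### Herglotz and Nevanlinna representations -/

theorem measurable_poissonKernel (z : ℂ) : Measurable (poissonKernel 0 z) := by
  unfold poissonKernel
  fun_prop

/-- The Poisson integral of the imaginary part of a function analytic up to the unit circle, as an
integral with respect to a measure on the circle. -/
theorem exists_measure_poissonKernel {G : ℂ → ℂ} (hG : DiffContOnCl ℂ G (Metric.ball 0 1))
    (hpos : ∀ z ∈ Metric.closedBall (0 : ℂ) 1, 0 ≤ (G z).im) :
    ∃ M : FiniteMeasure ℂ, M.mass = ((G 0).im).toNNReal ∧ M (Metric.sphere 0 1)ᶜ = 0 ∧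
      ∀ z ∈ Metric.ball (0 : ℂ) 1, ∫ ζ, poissonKernel 0 z ζ ∂(M : Measure ℂ) = (G z).im := by
  have hsph : ∀ θ : ℝ, circleMap 0 1 θ ∈ Metric.sphere (0 : ℂ) 1 := fun θ =>
    circleMap_mem_sphere 0 zero_le_one θ
  have hsc : Metric.sphere (0 : ℂ) 1 ⊆ Metric.closedBall 0 1 := Metric.sphere_subset_closedBall
  have hcont : ContinuousOn G (Metric.closedBall 0 1) := hG.continuousOn_ball
  set d : ℝ → ℝ := fun θ => (2 * Real.pi)⁻¹ * (G (circleMap 0 1 θ)).im with hd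
  have hdc : Continuous d := by
    refine continuous_const.mul (Complex.continuous_im.comp ?_)
    exact hcont.comp_continuous (continuous_circleMap 0 1) fun θ => hsc (hsph θ)
  have hd0 : ∀ θ, 0 ≤ d θ := fun θ =>
    mul_nonneg (by positivity) (hpos _ (hsc (hsph θ)))
  set ρ : Measure ℝ := (volume.restrict (Ioc 0 (2 * Real.pi))).withDensity
    (fun θ => ((d θ).toNNReal : ENNReal)) with hρ
  have hdm : Measurable fun θ => (d θ).toNNReal := hdc.measurable.real_toNNReal
  have hfin : IsFiniteMeasure ρ := by
    refine isFiniteMeasure_withDensity_ofReal ?_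
    exact ((hdc.integrableOn_Icc (a := 0) (b := 2 * Real.pi)).mono_set Ioc_subset_Icc_self).2
  have hcm : Measurable (circleMap 0 1) := (continuous_circleMap 0 1).measurable
  have hint : ∀ g : ℂ → ℝ, Measurable g → ∫ ζ, g ζ ∂(ρ.map (circleMap 0 1)) =
      Real.circleAverage (fun ζ => g ζ * (G ζ).im) 0 1 := fun g hg => by
    rw [integral_map hcm.aemeasurable hg.aestronglyMeasurable, hρ,
      integral_withDensity_eq_integral_smul hdm, Real.circleAverage_def,
      intervalIntegral.integral_of_le (by positivity), smul_eq_mul, ← integral_const_mul]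
    refine integral_congr_ae (Eventually.of_forall fun θ => ?_)
    beta_reduce
    rw [NNReal.smul_def, smul_eq_mul, Real.coe_toNNReal _ (hd0 θ)]
    simp only [hd]
    ring
  have hpk : ∀ z ∈ Metric.ball (0 : ℂ) 1,
      ∫ ζ, poissonKernel 0 z ζ ∂(ρ.map (circleMap 0 1)) = (G z).im := fun z hz => by
    rw [hint _ (measurable_poissonKernel z)]
    have h1 := hG.circleAverage_poissonKernel_smul hz
    have hci : CircleIntegrable (poissonKernel 0 z • G) 0 1 := by
      refine ContinuousOn.circleIntegrable zero_le_one ?_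
      refine ContinuousOn.smul ?_ (hcont.mono hsc)
      unfold poissonKernel
      refine ContinuousOn.div (by fun_prop) (by fun_prop) fun ζ hζ => ?_
      have : ζ ≠ z := by
        rintro rfl
        simp at hz hζ
        linarith
      simpa [sub_eq_zero] using this
    rw [← h1, ← Complex.imCLM_apply, ← Complex.imCLM.circleAverage_comp_comm hci]
    congr 1
    ext ζ
    simp
  have hmapfin : IsFiniteMeasure (ρ.map (circleMap 0 1)) := inferInstance
  set Mf : FiniteMeasure ℂ := ⟨ρ.map (circleMap 0 1), hmapfin⟩ with hMf
  refine ⟨Mf, ?_, ?_, hpk⟩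
  · have h0 := hpk 0 (by simp)
    have h1 : ∫ ζ, poissonKernel 0 0 ζ ∂(ρ.map (circleMap 0 1)) =
        ∫ ζ, (1 : ℝ) ∂(ρ.map (circleMap 0 1)) := by
      rw [integral_map hcm.aemeasurable (measurable_poissonKernel 0).aestronglyMeasurable,
        integral_map hcm.aemeasurable (by fun_prop)]
      refine integral_congr_ae (Eventually.of_forall fun θ => ?_)
      simp [poissonKernel]
    rw [h1, integral_const, smul_eq_mul, mul_one] at h0
    rw [← h0]
    exact NNReal.eq (Real.coe_toNNReal _ ENNReal.toReal_nonneg).symm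
  · refine (FiniteMeasure.null_iff_toMeasure_null Mf _).2 ?_
    change (ρ.map (circleMap 0 1)) (Metric.sphere 0 1)ᶜ = 0
    rw [Measure.map_apply hcm Metric.isClosed_sphere.measurableSet.compl]
    convert measure_empty (μ := ρ)
    ext θ
    simp

/-- The Poisson kernel of the disk, as a bounded continuous function on the plane. -/
noncomputable def poissonBCF (z : ℂ) (hz : ‖z‖ < 1) : BoundedContinuousFunction ℂ ℝ :=
  BoundedContinuousFunction.ofNormedAddCommGroup
    (fun ζ => (1 - ‖z‖ ^ 2) / max ‖ζ - z‖ (1 - ‖z‖) ^ 2)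
    (by
      refine Continuous.div continuous_const (by fun_prop) fun ζ => ?_
      have : 0 < max ‖ζ - z‖ (1 - ‖z‖) := lt_max_of_lt_right (by linarith)
      positivity)
    ((1 - ‖z‖ ^ 2) / (1 - ‖z‖) ^ 2)
    (fun ζ => by
      have h1 : 0 < 1 - ‖z‖ := by linarith
      have h2 : 0 ≤ 1 - ‖z‖ ^ 2 := by nlinarith [norm_nonneg z]
      have h3 : 1 - ‖z‖ ≤ max ‖ζ - z‖ (1 - ‖z‖) := le_max_right _ _
      rw [Real.norm_of_nonneg (by positivity)]
      gcongr)

/-- On the circle |ζ - z| ≥ 1 - |z|, so the truncation by the maximum is inactive. It serves only to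
make the kernel a legitimate test function for weak convergence on the whole plane. -/
theorem poissonBCF_eq {z : ℂ} (hz : ‖z‖ < 1) {ζ : ℂ} (hζ : ζ ∈ Metric.sphere (0 : ℂ) 1) :
    poissonBCF z hz ζ = poissonKernel 0 z ζ := by
  have h : ‖ζ‖ = 1 := by simpa using hζ
  have h2 : 1 - ‖z‖ ≤ ‖ζ - z‖ := by
    rw [← h]; exact norm_sub_norm_le ζ z
  simp [poissonBCF, poissonKernel, h, max_eq_left h2]

/-- The **Herglotz representation** of the positive harmonic function `Im f` on the disk. -/
theorem exists_herglotz_measure {f : ℂ → ℂ} (hf : DifferentiableOn ℂ f unitDisk)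
    (hpos : ∀ z ∈ unitDisk, 0 ≤ (f z).im) :
    ∃ m : Measure ℂ, IsFiniteMeasure m ∧ m (Metric.sphere 0 1)ᶜ = 0 ∧
      ∀ z ∈ unitDisk, Integrable (poissonKernel 0 z) m ∧
        (f z).im = ∫ ζ, poissonKernel 0 z ζ ∂m := by
  have hae : ∀ (m : Measure ℂ), m (Metric.sphere 0 1)ᶜ = 0 → ∀ z (hz : ‖z‖ < 1),
      poissonBCF z hz =ᵐ[m] poissonKernel 0 z := fun m hm z hz => by
    have : ∀ᵐ ζ ∂m, ζ ∈ Metric.sphere (0 : ℂ) 1 := by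
      rw [ae_iff]; exact hm
    filter_upwards [this] with ζ hζ using poissonBCF_eq hz hζ
  -- The dilates f(Rz) are analytic up to the circle, and all their measures have the same mass Im
  -- f(0). Outside (0, 1) the zero measure is a filler that makes the choice total.
  have hex : ∀ R : ℝ, ∃ M : FiniteMeasure ℂ, R ∈ Ioo (0 : ℝ) 1 →
      M.mass = ((f 0).im).toNNReal ∧ M (Metric.sphere 0 1)ᶜ = 0 ∧
      ∀ z ∈ unitDisk, ∫ ζ, poissonKernel 0 z ζ ∂(M : Measure ℂ) = (f (R * z)).im := fun R => by
    by_cases hR : R ∈ Ioo (0 : ℝ) 1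
    · have hmaps : ∀ z ∈ Metric.closedBall (0 : ℂ) 1, (R : ℂ) * z ∈ unitDisk := fun z hz => by
        have hz' : ‖z‖ ≤ 1 := by simpa using hz
        rw [mem_unitDisk, norm_mul, Complex.norm_real, Real.norm_of_nonneg hR.1.le]
        nlinarith [hR.1, hR.2, norm_nonneg z]
      have hG : DifferentiableOn ℂ (fun z => f (R * z)) (Metric.closedBall 0 1) :=
        hf.comp (by fun_prop) hmaps
      have hG2 : DiffContOnCl ℂ (fun z => f (R * z)) (Metric.ball 0 1) :=
        ⟨hG.mono Metric.ball_subset_closedBall, by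
          rw [closure_ball (0 : ℂ) one_ne_zero]; exact hG.continuousOn⟩
      obtain ⟨M, h1, h2, h3⟩ := exists_measure_poissonKernel hG2
        fun z hz => hpos _ (hmaps z hz)
      exact ⟨M, fun _ => ⟨by simpa using h1, h2, h3⟩⟩
    · exact ⟨0, fun h => absurd h hR⟩
  choose M hM using hex
  -- An ultrafilter below the left neighbourhoods of 1 turns weak compactness directly into
  -- convergence, without extracting subsequences.
  set U : Ultrafilter ℝ := Ultrafilter.of (𝓝[<] (1 : ℝ))
  have hU : (U : Filter ℝ) ≤ 𝓝[<] (1 : ℝ) := Ultrafilter.of_le _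
  have hev : ∀ᶠ R in (U : Filter ℝ), R ∈ Ioo (0 : ℝ) 1 :=
    hU (Ioo_mem_nhdsLT zero_lt_one)
  obtain ⟨m, hm, hlim⟩ := (isCompact_setOfPred_finiteMeasure_le_of_isCompact ((f 0).im).toNNReal
    (isCompact_sphere (0 : ℂ) 1)).ultrafilter_le_nhds' (U.map M) (by
      rw [Ultrafilter.mem_map]
      filter_upwards [hev] with R hR
      exact ⟨(hM R hR).1.le, (hM R hR).2.1⟩)
  have hm0 : (m : Measure ℂ) (Metric.sphere 0 1)ᶜ = 0 :=
    (FiniteMeasure.null_iff_toMeasure_null m _).1 hm.2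
  refine ⟨m, inferInstance, hm0, fun z hz => ?_⟩
  have hz1 := mem_unitDisk.1 hz
  refine ⟨((poissonBCF z hz1).integrable m).congr (hae m hm0 z hz1), ?_⟩
  have htend : Tendsto M U (𝓝 m) := hlim
  have t1 := FiniteMeasure.tendsto_iff_forall_integral_tendsto.1 htend (poissonBCF z hz1)
  rw [integral_congr_ae (hae m hm0 z hz1)] at t1
  have t2 : Tendsto (fun R : ℝ => (f (R * z)).im) U (𝓝 (f z).im) := by
    have c1 : ContinuousAt f z := hf.continuousOn.continuousAt (Metric.isOpen_ball.mem_nhds hz)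
    have c2 : Tendsto (fun R : ℝ => (R : ℂ) * z) (𝓝 1) (𝓝 z) := by
      have : Continuous fun R : ℝ => (R : ℂ) * z := by fun_prop
      simpa using this.tendsto 1
    exact (Complex.continuous_im.tendsto _).comp
      (c1.tendsto.comp (c2.mono_left (hU.trans nhdsWithin_le_nhds)))
  refine tendsto_nhds_unique (t2.congr' ?_) t1
  filter_upwards [hev] with R hR
  obtain ⟨-, h2, h3⟩ := hM R hR
  rw [integral_congr_ae (hae (M R) ((FiniteMeasure.null_iff_toMeasure_null _ _).1 h2) z hz1),
    h3 z hz]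

theorem norm_cayleyAt_I_ofReal (t : ℝ) : ‖cayleyAt Complex.I t‖ = 1 := by
  have h := one_sub_norm_cayleyAt (a := Complex.I) (w := t) (by simp) (by simp)
  simp only [Complex.ofReal_im, mul_zero, zero_div] at h
  nlinarith [norm_nonneg (cayleyAt Complex.I t)]

theorem ofReal_sub_ne_zero {w : ℂ} (hw : 0 < w.im) (t : ℝ) : (t : ℂ) - w ≠ 0 := by
  intro h
  have := congrArg Complex.im h
  simp at this
  linarith

theorem norm_ofReal_sub_pos {w : ℂ} (hw : 0 < w.im) (t : ℝ) : 0 < ‖(t : ℂ) - w‖ :=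
  norm_pos_iff.2 (ofReal_sub_ne_zero hw t)

theorem norm_ofReal_sub_sq (w : ℂ) (t : ℝ) : ‖(t : ℂ) - w‖ ^ 2 = (t - w.re) ^ 2 + w.im ^ 2 := by
  rw [← Complex.normSq_eq_norm_sq, Complex.normSq_apply]
  simp
  ring

/-- The Poisson kernel of the disk in half plane coordinates, at a finite boundary point. -/
theorem poissonKernel_cayleyAt_ofReal {w : ℂ} (hw : 0 < w.im) (t : ℝ) :
    poissonKernel 0 (cayleyAt Complex.I w) (cayleyAt Complex.I t) =
      w.im * (1 + t ^ 2) / ‖(t : ℂ) - w‖ ^ 2 := by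
  have h1 : w + Complex.I ≠ 0 := by
    simpa using sub_conj_ne_zero (a := Complex.I) (w := w) (by simp) hw.le
  have h2 : (t : ℂ) + Complex.I ≠ 0 := by
    simpa using sub_conj_ne_zero (a := Complex.I) (w := t) (by simp) (by simp)
  have e : cayleyAt Complex.I t - cayleyAt Complex.I w =
      2 * Complex.I * (t - w) / ((t + Complex.I) * (w + Complex.I)) := by
    simp only [cayleyAt, Complex.conj_I, sub_neg_eq_add]
    rw [div_sub_div _ _ h2 h1]
    congr 1
    ring
  have e2 : ‖(t : ℂ) + Complex.I‖ ^ 2 = 1 + t ^ 2 := by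
    rw [← Complex.normSq_eq_norm_sq, Complex.normSq_apply]
    simp
    ring
  have e3 := one_sub_norm_cayleyAt (a := Complex.I) (by simp) hw.le
  simp only [Complex.I_im, mul_one, Complex.conj_I, sub_neg_eq_add] at e3
  have p1 := norm_pos_iff.2 h1
  have p2 := norm_pos_iff.2 h2
  have p3 := norm_ofReal_sub_pos hw t
  rw [poissonKernel_def]
  simp only [sub_zero]
  rw [norm_cayleyAt_I_ofReal, one_pow, e3, e, norm_div, norm_mul, norm_mul, norm_mul, ← e2]
  simp only [Complex.norm_ofNat, Complex.norm_I, mul_one]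
  field_simp
  norm_num

/-- The Poisson kernel of the disk in half plane coordinates, at infinity. -/
theorem poissonKernel_cayleyAt_one {w : ℂ} (hw : 0 < w.im) :
    poissonKernel 0 (cayleyAt Complex.I w) 1 = w.im := by
  have h1 : w + Complex.I ≠ 0 := by
    simpa using sub_conj_ne_zero (a := Complex.I) (w := w) (by simp) hw.le
  have e : 1 - cayleyAt Complex.I w = 2 * Complex.I / (w + Complex.I) := by
    simp only [cayleyAt, Complex.conj_I, sub_neg_eq_add]
    rw [eq_div_iff h1, sub_mul, div_mul_cancel₀ _ h1]
    ring
  have e3 := one_sub_norm_cayleyAt (a := Complex.I) (by simp) hw.le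
  simp only [Complex.I_im, mul_one, Complex.conj_I, sub_neg_eq_add] at e3
  have p1 := norm_pos_iff.2 h1
  rw [poissonKernel_def]
  simp only [sub_zero]
  rw [norm_one, one_pow, e3, e, norm_div, norm_mul]
  simp only [Complex.norm_ofNat, Complex.norm_I, mul_one]
  field_simp
  norm_num

/-- The **Nevanlinna representation** of a positive harmonic function `Im f` on the half plane. -/
theorem exists_nevanlinna_representation {f : ℂ → ℂ} (hf : DifferentiableOn ℂ f upperPlane)
    (hpos : ∀ w ∈ upperPlane, 0 ≤ (f w).im) :
    ∃ (b : ℝ) (ν : Measure ℝ), 0 ≤ b ∧ IsFiniteMeasure ν ∧ ∀ w ∈ upperPlane,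
      Integrable (fun t : ℝ => w.im * (1 + t ^ 2) / ‖(t : ℂ) - w‖ ^ 2) ν ∧
      (f w).im = b * w.im + ∫ t : ℝ, w.im * (1 + t ^ 2) / ‖(t : ℂ) - w‖ ^ 2 ∂ν := by
  have hI : 0 < Complex.I.im := by simp
  have hc := isConformalOnto_cayleyInv hI
  obtain ⟨m, hm, hm0, hrep⟩ := exists_herglotz_measure (f := fun z => f (cayleyInv Complex.I z))
    (hf.comp hc.1 hc.2.mapsTo) fun z hz => hpos _ (hc.2.mapsTo hz)
  -- On the circle minus 1 the inverse Cayley transform is already real, so taking the real part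
  -- loses nothing. The point 1 corresponds to infinity; its atom is split off and becomes the
  -- linear coefficient `b`.
  set T : ℂ → ℝ := fun ζ => (cayleyInv Complex.I ζ).re with hT
  have hTm : Measurable T := by
    refine Complex.measurable_re.comp ?_
    unfold cayleyInv
    fun_prop
  have hTs : ∀ ζ : ℂ, ζ ∈ Metric.sphere (0 : ℂ) 1 → ζ ≠ 1 → cayleyAt Complex.I (T ζ) = ζ :=
    fun ζ hζ h1 => by
      have hn : ‖ζ‖ = 1 := by simpa using hζ
      have : ((T ζ : ℝ) : ℂ) = cayleyInv Complex.I ζ := by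
        apply Complex.ext
        · simp [hT]
        · rw [im_cayleyInv h1, hn]; simp
      rw [this, cayleyAt_cayleyInv hI h1]
  set m' := m.restrict {1}ᶜ
  refine ⟨m.real {1}, m'.map T, by positivity, inferInstance, fun w hw => ?_⟩
  have hz : cayleyAt Complex.I w ∈ unitDisk := (isConformalOnto_cayleyAt hI).2.mapsTo hw
  obtain ⟨hi, he⟩ := hrep _ hz
  simp only [cayleyInv_cayleyAt hI (le_of_lt hw)] at he
  have hae : (fun ζ => w.im * (1 + T ζ ^ 2) / ‖(T ζ : ℂ) - w‖ ^ 2) =ᵐ[m']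
      poissonKernel 0 (cayleyAt Complex.I w) := by
    have h1 : ∀ᵐ ζ ∂m', ζ ∈ Metric.sphere (0 : ℂ) 1 :=
      ae_restrict_of_ae (by rw [ae_iff]; exact hm0)
    filter_upwards [h1, ae_restrict_mem (measurableSet_singleton _).compl] with ζ hζ hζ1
    rw [← poissonKernel_cayleyAt_ofReal hw, hTs ζ hζ hζ1]
  have hkm : Measurable fun t : ℝ => w.im * (1 + t ^ 2) / ‖(t : ℂ) - w‖ ^ 2 := by fun_prop
  have hi' : Integrable (poissonKernel 0 (cayleyAt Complex.I w)) m' := hi.restrict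
  refine ⟨?_, ?_⟩
  · rw [integrable_map_measure hkm.aestronglyMeasurable hTm.aemeasurable]
    exact hi'.congr hae.symm
  · rw [integral_map hTm.aemeasurable hkm.aestronglyMeasurable, integral_congr_ae hae, he,
      ← integral_add_compl (measurableSet_singleton (1 : ℂ)) hi, integral_singleton,
      poissonKernel_cayleyAt_one hw, smul_eq_mul]

/-! ### The Nevanlinna measure as a boundary limit -/

/-- The Poisson integral of `g`, up to the factor `π`. -/
noncomputable def poissonIntegral (g : ℝ → ℝ) (y t : ℝ) : ℝ :=
  ∫ x : ℝ, g x * (y / ((t - x) ^ 2 + y ^ 2))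

/-- The substitution x = t + ys moves the parameter from the kernel into `g`. Both the limit at `0`
and the bound by the supremum of `g` can then be read off. -/
theorem poissonIntegral_eq (g : ℝ → ℝ) {y : ℝ} (hy : 0 < y) (t : ℝ) :
    poissonIntegral g y t = ∫ s : ℝ, g (t + y * s) * (1 + s ^ 2)⁻¹ := by
  have h1 : ∀ s : ℝ, g (t + y * s) * (1 + s ^ 2)⁻¹ =
      y * (fun u => g (t + u) * (y / (u ^ 2 + y ^ 2))) (y * s) := fun s => by
    have : 0 < 1 + s ^ 2 := by positivity
    have h2 : (y * s) ^ 2 + y ^ 2 = y ^ 2 * (1 + s ^ 2) := by ring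
    simp only [h2]
    field_simp
  simp_rw [h1]
  rw [integral_const_mul, Measure.integral_comp_mul_left
    (fun u => g (t + u) * (y / (u ^ 2 + y ^ 2))) y, abs_of_pos (by positivity), smul_eq_mul,
    mul_inv_cancel_left₀ hy.ne', poissonIntegral]
  rw [← integral_add_left_eq_self (fun x => g x * (y / ((t - x) ^ 2 + y ^ 2))) t]
  simp

theorem tendsto_poissonIntegral {g : ℝ → ℝ} (hg : Continuous g) {B : ℝ} (hB : ∀ x, |g x| ≤ B)
    (t : ℝ) : Tendsto (fun y => poissonIntegral g y t) (𝓝[>] 0) (𝓝 (g t * Real.pi)) := by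
  have h : Tendsto (fun y : ℝ => ∫ s : ℝ, g (t + y * s) * (1 + s ^ 2)⁻¹) (𝓝[>] 0)
      (𝓝 (∫ s : ℝ, g t * (1 + s ^ 2)⁻¹)) := by
    refine tendsto_integral_filter_of_dominated_convergence (fun s => B * (1 + s ^ 2)⁻¹) ?_ ?_
      (integrable_inv_one_add_sq.const_mul B) ?_
    · refine Eventually.of_forall fun y => Continuous.aestronglyMeasurable ?_
      have : ∀ s : ℝ, 1 + s ^ 2 ≠ 0 := fun s => by positivity
      fun_prop (disch := assumption)
    · refine Eventually.of_forall fun y => Eventually.of_forall fun s => ?_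
      rw [norm_mul, Real.norm_eq_abs, Real.norm_of_nonneg (by positivity)]
      gcongr
      exact hB _
    · refine Eventually.of_forall fun s => Tendsto.mul_const _ ?_
      have : Continuous fun y : ℝ => g (t + y * s) := by fun_prop
      simpa using (this.tendsto 0).mono_left nhdsWithin_le_nhds
  rw [integral_const_mul, integral_univ_inv_one_add_sq] at h
  refine h.congr' ?_
  filter_upwards [self_mem_nhdsWithin] with y hy using (poissonIntegral_eq g hy t).symm

/-- For |t| ≤ 2R the supremum of `g` suffices; beyond that |t - x| ≥ |t|/2 on the support, so the
kernel is O(t⁻²) and beats the weight 1 + t². The bound does not depend on `y`, and constants are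
integrable against a finite measure, so dominated convergence applies. -/
theorem abs_poissonIntegral_le {g : ℝ → ℝ} (hgi : Integrable g) {B R : ℝ}
    (hB : ∀ x, |g x| ≤ B) (hR : 1 ≤ R) (hsupp : ∀ x, R < |x| → g x = 0) {y : ℝ} (hy : 0 < y)
    (hy1 : y < 1) (t : ℝ) :
    |(1 + t ^ 2) * poissonIntegral g y t| ≤
      (1 + 4 * R ^ 2) * (B * Real.pi) + 8 * ∫ x, |g x| := by
  have hB0 : 0 ≤ B := (abs_nonneg _).trans (hB 0)
  have hI0 : 0 ≤ ∫ x, |g x| := integral_nonneg fun x => abs_nonneg _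
  rw [abs_mul, abs_of_pos (by positivity : 0 < 1 + t ^ 2)]
  rcases le_or_gt |t| (2 * R) with ht | ht
  · have h1 : |poissonIntegral g y t| ≤ B * Real.pi := by
      rw [poissonIntegral_eq g hy, ← integral_univ_inv_one_add_sq, ← integral_const_mul,
        ← Real.norm_eq_abs]
      refine norm_integral_le_of_norm_le (integrable_inv_one_add_sq.const_mul B)
        (Eventually.of_forall fun s => ?_)
      rw [norm_mul, Real.norm_eq_abs, Real.norm_of_nonneg (by positivity)]
      gcongr
      exact hB _
    have h2 : t ^ 2 ≤ 4 * R ^ 2 := by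
      rw [← sq_abs]; nlinarith [abs_nonneg t]
    have := Real.pi_pos
    have : (1 + t ^ 2) * |poissonIntegral g y t| ≤ (1 + 4 * R ^ 2) * (B * Real.pi) := by
      gcongr
    linarith
  · have ht0 : 0 < t ^ 2 := by rw [← sq_abs]; nlinarith
    have h1 : |poissonIntegral g y t| ≤ ∫ x, 4 / t ^ 2 * |g x| := by
      rw [poissonIntegral, ← Real.norm_eq_abs]
      refine norm_integral_le_of_norm_le (hgi.abs.const_mul _) (Eventually.of_forall fun x => ?_)
      rw [norm_mul, Real.norm_eq_abs, Real.norm_of_nonneg (by positivity), mul_comm]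
      rcases le_or_gt |x| R with hx | hx
      · gcongr ?_ * _
        have h3 : |t| / 2 ≤ |t - x| := by
          have := abs_sub_abs_le_abs_sub t x
          linarith
        have h4 : t ^ 2 / 4 ≤ (t - x) ^ 2 := by
          rw [← sq_abs t, ← sq_abs (t - x)]
          nlinarith [abs_nonneg t]
        rw [div_le_div_iff₀ (by positivity) ht0]
        nlinarith [sq_nonneg y]
      · simp [hsupp x hx]
    rw [integral_const_mul] at h1
    have h2 : (1 + t ^ 2) * (4 / t ^ 2) ≤ 8 := by
      rw [← mul_div_assoc, div_le_iff₀ ht0]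
      have : 1 ≤ t ^ 2 := by rw [← sq_abs]; nlinarith
      linarith
    have h3 : (1 + t ^ 2) * |poissonIntegral g y t| ≤ 8 * ∫ x, |g x| := by
      calc _ ≤ (1 + t ^ 2) * (4 / t ^ 2 * ∫ x, |g x|) := by gcongr
        _ = ((1 + t ^ 2) * (4 / t ^ 2)) * ∫ x, |g x| := by ring
        _ ≤ _ := by gcongr
    have := Real.pi_pos
    have : 0 ≤ (1 + 4 * R ^ 2) * (B * Real.pi) := by positivity
    linarith

/-- The measure in `GammaRegularAt` is existentially quantified; uniqueness identifies it with the
one that represents Im f. -/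
theorem IsNevanlinnaMeasure.unique {f : ℂ → ℂ} {μ μ' : Measure ℝ} (h : IsNevanlinnaMeasure f μ)
    (h' : IsNevanlinnaMeasure f μ') : μ = μ' := by
  have := h.1
  have := h'.1
  refine Measure.ext_of_integral_eq_on_compactlySupported fun g => ?_
  exact tendsto_nhds_unique (h.2 g g.continuous g.hasCompactSupport)
    (h'.2 g g.continuous g.hasCompactSupport)

/-- This justifies Fubini for a fixed height `y`. Since x stays in a bounded set, 1 + t² ≤ 1 + 2R² +
2(t - x)², so the weighted kernel is bounded there. -/
theorem integrable_mul_kernel {g : ℝ → ℝ} (hg : Continuous g) (hgi : Integrable g) {R : ℝ}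
    (hR : 1 ≤ R) (hsupp : ∀ x, R < |x| → g x = 0) {y : ℝ} (hy : 0 < y) (ν : Measure ℝ)
    [IsFiniteMeasure ν] :
    Integrable (fun p : ℝ × ℝ => g p.1 * (y * (1 + p.2 ^ 2) / ((p.2 - p.1) ^ 2 + y ^ 2)))
      ((volume : Measure ℝ).prod ν) := by
  have hb : ∀ x t : ℝ, |x| ≤ R →
      y * (1 + t ^ 2) / ((t - x) ^ 2 + y ^ 2) ≤ (1 + 2 * R ^ 2) / y + 2 * y := fun x t hx => by
    have h1 : x ^ 2 ≤ R ^ 2 := sq_le_sq' (by linarith [neg_abs_le x]) (by linarith [le_abs_self x])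
    have h2 : 1 + t ^ 2 ≤ (1 + 2 * R ^ 2) + 2 * (t - x) ^ 2 := by nlinarith [sq_nonneg (t - 2 * x)]
    rw [div_le_iff₀ (by positivity)]
    have h3 : ((1 + 2 * R ^ 2) / y + 2 * y) * ((t - x) ^ 2 + y ^ 2) =
      (1 + 2 * R ^ 2) / y * (t - x) ^ 2 + (1 + 2 * R ^ 2) * y + 2 * y * (t - x) ^ 2 +
        2 * y * y ^ 2 := by
      field_simp
      ring
    rw [h3]
    have h4 : 0 ≤ (1 + 2 * R ^ 2) / y * (t - x) ^ 2 := by positivity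
    have h5 : 0 ≤ 2 * y * y ^ 2 := by positivity
    nlinarith
  have hdom : Integrable (fun p : ℝ × ℝ => |g p.1| * ((1 + 2 * R ^ 2) / y + 2 * y))
      ((volume : Measure ℝ).prod ν) :=
    hgi.abs.mul_prod (integrable_const _)
  refine hdom.mono' (Continuous.aestronglyMeasurable ?_) (Eventually.of_forall fun p => ?_)
  · have : ∀ p : ℝ × ℝ, (p.2 - p.1) ^ 2 + y ^ 2 ≠ 0 := fun p => by positivity
    fun_prop (disch := assumption)
  · rw [norm_mul, Real.norm_eq_abs, Real.norm_of_nonneg (by positivity)]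
    rcases le_or_gt |p.1| R with hx | hx
    · gcongr
      exact hb _ _ hx
    · simp [hsupp _ hx]

/-- Existence of the Nevanlinna measure, and the representation of `Im f` in terms of it. -/
theorem exists_isNevanlinnaMeasure {f : ℂ → ℂ} (hf : DifferentiableOn ℂ f upperPlane)
    (hpos : ∀ w ∈ upperPlane, 0 ≤ (f w).im) :
    ∃ (b : ℝ) (μ : Measure ℝ), 0 ≤ b ∧ IsNevanlinnaMeasure f μ ∧
      ∫⁻ t : ℝ, ENNReal.ofReal ((1 + t ^ 2)⁻¹) ∂μ < ⊤ ∧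
      ∀ w ∈ upperPlane, ENNReal.ofReal (f w).im = ENNReal.ofReal (b * w.im) +
        ∫⁻ t : ℝ, ENNReal.ofReal (w.im / (Real.pi * ‖(t : ℂ) - w‖ ^ 2)) ∂μ := by
  obtain ⟨b, ν, hb, hν, hrep⟩ := exists_nevanlinna_representation hf hpos
  have hpi := Real.pi_pos
  set d : ℝ → ℝ := fun t => Real.pi * (1 + t ^ 2) with hd
  have hd0 : ∀ t, 0 < d t := fun t => by positivity
  have hdc : Continuous d := by fun_prop
  have hdm : Measurable fun t => (d t).toNNReal := hdc.measurable.real_toNNReal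
  -- The density π(1 + t²) undoes the normalization of `ν`, leaving the Poisson kernel of the half
  -- plane. Finiteness of `ν` turns into finiteness of ∫ dμ/(1 + t²).
  set μ : Measure ℝ := ν.withDensity fun t => ((d t).toNNReal : ENNReal) with hμ
  have hlint : ∀ k : ℝ → ℝ, Measurable k → ∫⁻ t, ENNReal.ofReal (k t) ∂μ =
      ∫⁻ t, ENNReal.ofReal (d t * k t) ∂ν := fun k hk => by
    rw [hμ, lintegral_withDensity_eq_lintegral_mul _ hdm.coe_nnreal_ennreal
      (by fun_prop)]
    refine lintegral_congr fun t => ?_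
    rw [ENNReal.ofReal_mul (hd0 t).le]
    rfl
  have hint : ∀ g : ℝ → ℝ, ∫ t, g t ∂μ = ∫ t, d t * g t ∂ν := fun g => by
    rw [hμ, integral_withDensity_eq_integral_smul hdm]
    refine integral_congr_ae (Eventually.of_forall fun t => ?_)
    beta_reduce
    rw [NNReal.smul_def, smul_eq_mul, Real.coe_toNNReal _ (hd0 t).le]
  refine ⟨b, μ, hb, ⟨?_, fun g hg hgs => ?_⟩, ?_, fun w hw => ?_⟩
  · exact IsLocallyFiniteMeasure.withDensity_coe (f := fun t => (d t).toNNReal)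
      (by fun_prop)
  · have hgi : Integrable g := hg.integrable_of_hasCompactSupport hgs
    obtain ⟨B, hB⟩ : ∃ B, ∀ x, |g x| ≤ B := by
      obtain ⟨B, hB⟩ := hgs.exists_bound_of_continuous hg
      exact ⟨B, hB⟩
    obtain ⟨R, hR, hsupp⟩ : ∃ R : ℝ, 1 ≤ R ∧ ∀ x, R < |x| → g x = 0 := by
      obtain ⟨R, hR⟩ := hgs.isCompact.isBounded.subset_closedBall 0
      refine ⟨max R 1, le_max_right _ _, fun x hx => image_eq_zero_of_notMem_tsupport fun h => ?_⟩
      have := hR h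
      rw [Metric.mem_closedBall, dist_zero_right, Real.norm_eq_abs] at this
      exact absurd (this.trans (le_max_left R 1)) (not_le.2 hx)
    have hform : ∀ y : ℝ, 0 < y → ∫ x : ℝ, g x * (f (x + y * Complex.I)).im =
        b * y * (∫ x, g x) + ∫ t, (1 + t ^ 2) * poissonIntegral g y t ∂ν := fun y hy => by
      have hk := integrable_mul_kernel hg hgi hR hsupp hy ν
      have e1 : ∀ x : ℝ, g x * (f (x + y * Complex.I)).im = b * y * g x +
          ∫ t : ℝ, g x * (y * (1 + t ^ 2) / ((t - x) ^ 2 + y ^ 2)) ∂ν := fun x => by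
        have hw : (x + y * Complex.I : ℂ) ∈ upperPlane := by simpa [upperPlane] using hy
        rw [(hrep _ hw).2]
        simp_rw [norm_ofReal_sub_sq]
        simp only [Complex.add_im, Complex.ofReal_im, Complex.mul_im, Complex.ofReal_re,
          Complex.I_im, Complex.I_re, mul_zero, mul_one, zero_add, add_zero, Complex.add_re,
          Complex.mul_re, sub_self]
        rw [integral_const_mul]
        ring
      simp_rw [e1]
      rw [integral_add (hgi.const_mul _) hk.integral_prod_left, integral_const_mul,
        integral_integral_swap hk]
      congr 1
      refine integral_congr_ae (Eventually.of_forall fun t => ?_)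
      beta_reduce
      rw [poissonIntegral, ← integral_const_mul]
      refine integral_congr_ae (Eventually.of_forall fun x => ?_)
      beta_reduce
      ring
    have t1 : Tendsto (fun y : ℝ => b * y * (∫ x, g x)) (𝓝[>] 0) (𝓝 0) := by
      have : Continuous fun y : ℝ => b * y * (∫ x, g x) := by fun_prop
      simpa using (this.tendsto 0).mono_left nhdsWithin_le_nhds
    have t2 : Tendsto (fun y : ℝ => ∫ t, (1 + t ^ 2) * poissonIntegral g y t ∂ν) (𝓝[>] 0)
        (𝓝 (∫ t, (1 + t ^ 2) * (g t * Real.pi) ∂ν)) := by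
      refine tendsto_integral_filter_of_dominated_convergence
        (fun _ => (1 + 4 * R ^ 2) * (B * Real.pi) + 8 * ∫ x, |g x|) ?_ ?_ (integrable_const _) ?_
      · filter_upwards [self_mem_nhdsWithin] with y hy
        refine AEStronglyMeasurable.mul (by fun_prop) ?_
        have hc : Continuous fun p : ℝ × ℝ => g p.2 * (y / ((p.1 - p.2) ^ 2 + y ^ 2)) := by
          have : ∀ p : ℝ × ℝ, (p.1 - p.2) ^ 2 + y ^ 2 ≠ 0 := fun p => by
            have : 0 < y := hy
            positivity
          fun_prop (disch := assumption)
        exact hc.stronglyMeasurable.integral_prod_right.aestronglyMeasurable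
      · filter_upwards [Ioo_mem_nhdsGT zero_lt_one] with y hy
        exact Eventually.of_forall fun t => abs_poissonIntegral_le hgi hB hR hsupp hy.1 hy.2 t
      · exact Eventually.of_forall fun t => (tendsto_poissonIntegral hg hB t).const_mul _
    have t3 := t1.add t2
    rw [zero_add] at t3
    have e3 : ∫ x, g x ∂μ = ∫ t, (1 + t ^ 2) * (g t * Real.pi) ∂ν := by
      rw [hint]
      refine integral_congr_ae (Eventually.of_forall fun t => ?_)
      simp only [hd]
      ring
    rw [e3]
    refine t3.congr' ?_
    filter_upwards [self_mem_nhdsWithin] with y hy using (hform y hy).symm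
  · rw [hlint _ (by fun_prop)]
    have : ∀ t : ℝ, d t * (1 + t ^ 2)⁻¹ = Real.pi := fun t => by
      have : 0 < 1 + t ^ 2 := by positivity
      simp only [hd]
      field_simp
    simp_rw [this]
    rw [lintegral_const]
    exact ENNReal.mul_lt_top ENNReal.ofReal_lt_top (measure_lt_top _ _)
  · obtain ⟨hi, he⟩ := hrep w hw
    have hw0 : 0 < w.im := hw
    rw [he, ENNReal.ofReal_add (by positivity) (integral_nonneg fun t => by positivity),
      ofReal_integral_eq_lintegral_ofReal hi (Eventually.of_forall fun t => by positivity),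
      hlint _ (by fun_prop)]
    congr 1
    refine lintegral_congr fun t => ?_
    congr 1
    have := norm_ofReal_sub_pos hw0 t
    simp only [hd]
    field_simp

/-! ### Consequences of the augury condition -/

section Gauge

variable {γ : ℝ → ℝ}

/-- The augury integrand takes one-sided limits of `γ` itself, while the measure comes from its
constant extension. They agree away from `0`, and at `0` the factor t makes the integrand vanish. -/
theorem leftLim_monotone_extend (hmono : MonotoneOn γ (Ici 0)) {t : ℝ} (ht : 0 < t) :
    Function.leftLim γ t = Function.leftLim (fun t : ℝ => γ (max t 0)) t := by
  refine leftLim_eq_of_tendsto ?_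
  refine ((monotone_extend hmono).tendsto_leftLim t).congr' ?_
  filter_upwards [nhdsWithin_le_nhds (Ioi_mem_nhds ht)] with s hs
  rw [max_eq_left (le_of_lt hs)]

theorem rightLim_monotone_extend (hmono : MonotoneOn γ (Ici 0)) {t : ℝ} (ht : 0 < t) :
    Function.rightLim γ t = Function.rightLim (fun t : ℝ => γ (max t 0)) t := by
  refine rightLim_eq_of_tendsto ?_
  refine ((monotone_extend hmono).tendsto_rightLim t).congr' ?_
  filter_upwards [nhdsWithin_le_nhds (Ioi_mem_nhds ht)] with s hs
  rw [max_eq_left (le_of_lt hs)]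

theorem tendsto_zero_of_isBigO_sq (hO : γ =O[𝓝[>] 0] fun t : ℝ => t ^ 2) :
    Tendsto γ (𝓝[>] 0) (𝓝 0) := by
  refine hO.trans_tendsto ?_
  have : Continuous fun t : ℝ => t ^ 2 := by fun_prop
  simpa using (this.tendsto 0).mono_left nhdsWithin_le_nhds

/-- The pointwise consequence of the integrability condition of an augury. -/
theorem IsAugury.exists_mul_sqrt_le (hmono : MonotoneOn γ (Ici 0))
    (hpos : ∀ t : ℝ, 0 < t → 0 < γ t) (hO : γ =O[𝓝[>] 0] fun t : ℝ => t ^ 2)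
    (haug : IsAugury γ hmono (fun t : ℝ => √(γ t))) :
    ∃ C M a₀ : ℝ, 0 < C ∧ C < 1 ∧ 0 < M ∧ 0 < a₀ ∧
      ∀ a ∈ Ioo 0 a₀, a * √(γ (C * a)) ≤ M * γ a := by
  obtain ⟨-, -, C, hC, hint⟩ := haug
  set G : ℝ → ℝ := fun t => γ (max t 0) with hG
  have hGm : Monotone G := monotone_extend hmono
  have hGpos : ∀ t, 0 < t → G t = γ t := fun t ht => by simp [hG, max_eq_left ht.le]
  set m := derivMeasure γ hmono with hm
  set L := Function.leftLim G
  set R := Function.rightLim G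
  have hLF : ∀ t, Function.leftLim (hGm.stieltjesFunction) t = L t := fun t => by
    have : (hGm.stieltjesFunction : ℝ → ℝ) = R := funext fun x => hGm.stieltjesFunction_eq x
    rw [this]
    exact leftLim_rightLim (hGm.tendsto_leftLim t)
  have hmIco : ∀ a b, m (Ico a b) = ENNReal.ofReal (L b - L a) := fun a b => by
    rw [hm, derivMeasure, StieltjesFunction.measure_Ico, hLF, hLF]
  have hmsing : ∀ b, m {b} = ENNReal.ofReal (R b - L b) := fun b => by
    rw [hm, derivMeasure, StieltjesFunction.measure_singleton, hLF, hGm.stieltjesFunction_eq]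
  have hLpos : ∀ t, 0 < t → 0 < L t := fun t ht => by
    refine lt_of_lt_of_le (hpos (t / 2) (by linarith)) ?_
    rw [← hGpos _ (by linarith)]
    exact hGm.le_leftLim (by linarith)
  have hLR : ∀ t, L t ≤ R t := fun t => hGm.leftLim_le_rightLim le_rfl
  set h : ℝ → ℝ := fun t => t * √(γ (C * t)) / (Function.leftLim γ t * Function.rightLim γ t)
    with hh
  have hht : ∀ t, 0 < t → h t = t * √(γ (C * t)) / (L t * R t) := fun t ht => by
    simp only [hh]
    rw [leftLim_monotone_extend hmono ht, rightLim_monotone_extend hmono ht]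
  have hh0 : ∀ t ∈ Ico (0 : ℝ) 1, 0 ≤ h t := fun t ht => by
    rcases ht.1.eq_or_lt with h0 | h0
    · simp [hh, ← h0]
    · rw [hht t h0]
      have h1 := hLpos t h0
      have h2 : 0 < R t := h1.trans_le (hLR t)
      positivity
  set M := ∫ t in Ico 0 1, h t ∂m with hM
  have hM0 : 0 ≤ M := setIntegral_nonneg measurableSet_Ico hh0
  have hconst : ∀ (S : Set ℝ) (c : ℝ), MeasurableSet S → S ⊆ Ico 0 1 → m S ≠ ⊤ →
      (∀ t ∈ S, c ≤ h t) → c * m.real S ≤ M := fun S c hS hS1 hSf hc =>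
    (setIntegral_ge_of_const_le_real hS hSf hc (hint.mono_set hS1)).trans
      (setIntegral_mono_set hint ((ae_restrict_mem measurableSet_Ico).mono hh0)
        hS1.eventuallyLE)
  -- the range of `a`
  have hlim := tendsto_zero_of_isBigO_sq hO
  have hhalf : 0 < γ (1 / 2) := hpos _ (by norm_num)
  -- This ensures that `γ` passes the level 2γ(a) no later than 1/2, hence inside the domain of
  -- integration [0, 1).
  have hev : ∀ᶠ a in 𝓝[>] (0 : ℝ), 2 * γ a < γ (1 / 2) := by
    filter_upwards [hlim.eventually_lt_const (show (0 : ℝ) < γ (1 / 2) / 2 by linarith)]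
      with a ha
    linarith
  obtain ⟨a₀, ha₀, hsub⟩ := mem_nhdsGT_iff_exists_Ioo_subset.1 hev
  have ha₀' : (0 : ℝ) < a₀ := ha₀
  -- Lowering the constant below 1 is harmless by monotonicity and makes later iteration contract.
  -- The added 1 keeps the factor positive when the integral vanishes.
  refine ⟨min C (1 / 2), 8 * M + 1, min a₀ (1 / 2), by positivity,
    (min_le_right _ _).trans_lt (by norm_num), by positivity, by positivity, fun a ha => ?_⟩
  have ha0 : 0 < a := ha.1
  have ha12 : a < 1 / 2 := ha.2.trans_le (min_le_right _ _)
  have hag : 2 * γ a < γ (1 / 2) := hsub ⟨ha0, ha.2.trans_le (min_le_left _ _)⟩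
  set g := γ a with hg
  have hg0 : 0 < g := hpos a ha0
  set A := a * √(γ (C * a)) with hA
  have hA0 : 0 ≤ A := by positivity
  have hAt : ∀ t, a ≤ t → A ≤ t * √(γ (C * t)) := fun t hat => by
    have : γ (C * a) ≤ γ (C * t) := hmono (mem_Ici.2 (by positivity))
      (mem_Ici.2 (by have := ha0.trans_le hat; positivity)) (by gcongr)
    have : 0 ≤ t := ha0.le.trans hat
    simp only [hA]
    gcongr
  suffices hmain : A ≤ 8 * M * g by
    have : γ (min C (1 / 2) * a) ≤ γ (C * a) := hmono (mem_Ici.2 (by positivity))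
      (mem_Ici.2 (by positivity)) (by gcongr; exact min_le_left _ _)
    calc a * √(γ (min C (1 / 2) * a)) ≤ A := by simp only [hA]; gcongr
      _ ≤ 8 * M * g := hmain
      _ ≤ _ := by nlinarith
  -- the point where `γ` passes `2 γ(a)`
  set S := {t : ℝ | t ∈ Icc a (1 / 2) ∧ γ t ≤ 2 * g}
  have hSb : BddAbove S := ⟨1 / 2, fun t ht => ht.1.2⟩
  have haS : a ∈ S := ⟨⟨le_rfl, ha12.le⟩, by linarith⟩
  set b := sSup S
  have hab : a ≤ b := le_csSup hSb haS
  have hb12 : b ≤ 1 / 2 := csSup_le ⟨a, haS⟩ fun t ht => ht.1.2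
  have hb0 : 0 < b := ha0.trans_le hab
  have hlt : ∀ t, t < b → G t ≤ 2 * g := fun t ht => by
    obtain ⟨s, hs, hts⟩ := exists_lt_of_lt_csSup ⟨a, haS⟩ ht
    refine (hGm hts.le).trans ?_
    rw [hGpos s (ha0.trans_le hs.1.1)]
    exact hs.2
  have hgt : ∀ t, b < t → 2 * g ≤ G t := fun t ht => by
    rw [hGpos t (hb0.trans ht)]
    by_contra! hcon
    rcases le_or_gt t (1 / 2) with h1 | h1
    · exact absurd (le_csSup hSb ⟨⟨hab.trans ht.le, h1⟩, hcon.le⟩) (not_le.2 ht)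
    · have : γ (1 / 2) ≤ γ t := hmono (mem_Ici.2 (by norm_num)) (mem_Ici.2 (by linarith)) h1.le
      linarith
  have hLb : L b ≤ 2 * g := le_of_tendsto (hGm.tendsto_leftLim b) (by
    filter_upwards [self_mem_nhdsWithin] with t ht using hlt t ht)
  have hRb : 2 * g ≤ R b := ge_of_tendsto (hGm.tendsto_rightLim b) (by
    filter_upwards [self_mem_nhdsWithin] with t ht using hgt t ht)
  have hLa : L a ≤ g := by
    rw [hg, ← hGpos a ha0]; exact hGm.leftLim_le le_rfl
  -- The measure -d(1/γ) must gain mass at least 1/(8g) on [a, b]. Either `γ` has increased by g/2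
  -- before b, where the density is at least 1/(2g)², or it jumps at b from below 3g/2 to at least
  -- 2g, and the atom 1/L - 1/R suffices.
  rcases le_or_gt (3 / 2 * g) (L b) with hcase | hcase
  · have h1 := hconst (Ico a b) (A / (2 * g) ^ 2) measurableSet_Ico
      (Ico_subset_Ico ha0.le (hb12.trans (by norm_num))) (by simp [hmIco]) fun t ht => by
        have ht0 := ha0.trans_le ht.1
        have e1 : R t ≤ 2 * g := (hGm.rightLim_le_leftLim ht.2).trans hLb
        have e2 := (hLR t).trans e1
        have e3 := hLpos t ht0
        have e4 : 0 < R t := e3.trans_le (hLR t)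
        rw [hht t ht0, sq]
        gcongr
        exact hAt t ht.1
    rw [Measure.real, hmIco, ENNReal.toReal_ofReal (by linarith)] at h1
    have h2 : A / (2 * g) ^ 2 * (g / 2) ≤ M := by
      refine le_trans ?_ h1
      gcongr
      linarith
    have h3 : A / (2 * g) ^ 2 * (g / 2) = A / (8 * g) := by
      field_simp
      norm_num
    rw [h3, div_le_iff₀ (by positivity)] at h2
    linarith
  · have hLb0 := hLpos b hb0
    have h1 := hconst {b} (A / (L b * R b)) (measurableSet_singleton b)
      (singleton_subset_iff.2 ⟨hb0.le, by linarith⟩) (by simp [hmsing]) fun t ht => by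
        obtain rfl : t = b := ht
        rw [hht _ hb0]
        have : 0 < R b := hLb0.trans_le (hLR b)
        gcongr
        exact hAt _ hab
    rw [Measure.real, hmsing, ENNReal.toReal_ofReal (by linarith)] at h1
    have hRb0 : 0 < R b := hLb0.trans_le (hLR b)
    have h2 : A / (8 * g) ≤ A / (L b * R b) * (R b - L b) := by
      rw [div_mul_eq_mul_div, div_le_div_iff₀ (by positivity) (by positivity), mul_assoc A]
      refine mul_le_mul_of_nonneg_left ?_ hA0
      nlinarith
    have h3 := h2.trans h1
    rw [div_le_iff₀ (by positivity)] at h3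
    linarith

/-- If `√γ` is a `γ`-augury then `√γ` is dominated by `γ`, after rescaling the argument. -/
theorem IsAugury.exists_le_sq (hmono : MonotoneOn γ (Ici 0))
    (hpos : ∀ t : ℝ, 0 < t → 0 < γ t) (hO : γ =O[𝓝[>] 0] fun t : ℝ => t ^ 2)
    (haug : IsAugury γ hmono (fun t : ℝ => √(γ t))) :
    ∃ κ K a₀ : ℝ, 0 < κ ∧ 0 < K ∧ 0 < a₀ ∧ ∀ a ∈ Ioo 0 a₀, γ (κ * a) ≤ K * γ a ^ 2 := by
  obtain ⟨C, M, a₀, hC, hC1, hM, ha₀, hle⟩ := haug.exists_mul_sqrt_le hmono hpos hO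
  have hsq : ∀ a ∈ Ioo 0 a₀, a ^ 2 * γ (C * a) ≤ M ^ 2 * γ a ^ 2 := fun a ha => by
    have h1 : 0 ≤ a * √(γ (C * a)) := mul_nonneg ha.1.le (Real.sqrt_nonneg _)
    have h2 := pow_le_pow_left₀ h1 (hle a ha) 2
    rwa [mul_pow, mul_pow, Real.sq_sqrt (hpos _ (mul_pos hC ha.1)).le] at h2
  -- `γ(a) = o(a²)` gives that `γ(a) / a³` does not increase from `a` to `C a`
  have hsmall : ∀ᶠ a in 𝓝[>] (0 : ℝ), γ a ≤ C ^ 3 / M ^ 2 * a ^ 2 := by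
    have hc : 0 < √(C ^ 3 / M ^ 2) := Real.sqrt_pos.2 (by positivity)
    filter_upwards [haug.2.1.bound hc, self_mem_nhdsWithin] with a ha ha0
    have ha0' : (0 : ℝ) < a := ha0
    rw [Real.norm_of_nonneg (Real.sqrt_nonneg _), Real.norm_of_nonneg ha0'.le] at ha
    have := pow_le_pow_left₀ (Real.sqrt_nonneg _) ha 2
    rwa [mul_pow, Real.sq_sqrt (hpos a ha0').le, Real.sq_sqrt (by positivity)] at this
  obtain ⟨a₂, ha₂, hsub⟩ := mem_nhdsGT_iff_exists_Ioo_subset.1 hsmall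
  have ha₂' : (0 : ℝ) < a₂ := ha₂
  set a₁ := min a₀ a₂ / 2
  have ha₁ : 0 < a₁ := by positivity
  have ha₁₀ : a₁ < a₀ := by
    have := min_le_left a₀ a₂
    have : 0 < min a₀ a₂ := by positivity
    simp only [a₁]; linarith
  have ha₁₂ : a₁ < a₂ := by
    have := min_le_right a₀ a₂
    have : 0 < min a₀ a₂ := by positivity
    simp only [a₁]; linarith
  -- One factor γ(a) in a²γ(Ca) ≤ M²γ(a)² is replaced by its o(a²) bound. The constant C³/M² is
  -- chosen so that the contraction ratio is exactly C³, which iterates to γ(a) = O(a³).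
  have hstep : ∀ a, 0 < a → a ≤ a₁ → γ (C * a) ≤ C ^ 3 * γ a := fun a ha ha' => by
    have h1 := hsq a ⟨ha, ha'.trans_lt ha₁₀⟩
    have h2 : γ a ≤ C ^ 3 / M ^ 2 * a ^ 2 := hsub ⟨ha, ha'.trans_lt ha₁₂⟩
    have h3 : M ^ 2 * γ a ^ 2 ≤ a ^ 2 * (C ^ 3 * γ a) := by
      calc M ^ 2 * γ a ^ 2 = M ^ 2 * γ a * γ a := by ring
        _ ≤ M ^ 2 * γ a * (C ^ 3 / M ^ 2 * a ^ 2) := by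
          have := hpos a ha
          gcongr
        _ = _ := by field_simp
    exact le_of_mul_le_mul_left (h1.trans h3) (by positivity)
  have hiter : ∀ (n : ℕ) (a : ℝ), 0 < a → a ≤ a₁ → γ (C ^ n * a) ≤ (C ^ n) ^ 3 * γ a :=
    fun n a ha ha' => by
    induction n with
    | zero => simp
    | succ n ih =>
      have e : C ^ (n + 1) * a = C * (C ^ n * a) := by ring
      have h1 : C ^ n * a ≤ a₁ := by
        have : C ^ n ≤ 1 := pow_le_one₀ hC.le hC1.le
        nlinarith
      rw [e]
      calc γ (C * (C ^ n * a)) ≤ C ^ 3 * γ (C ^ n * a) := hstep _ (by positivity) h1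
        _ ≤ C ^ 3 * ((C ^ n) ^ 3 * γ a) := by gcongr
        _ = _ := by ring
  set B := γ a₁ / (C * a₁) ^ 3
  have hB : 0 < B := div_pos (hpos _ ha₁) (by positivity)
  have hcube : ∀ a, 0 < a → a ≤ a₁ → γ a ≤ B * a ^ 3 := fun a ha ha' => by
    obtain ⟨n, hn1, hn2⟩ := exists_nat_pow_near_of_lt_one (x := a / a₁) (y := C) (by positivity)
      ((div_le_one ha₁).2 ha') hC hC1
    have hCn : 0 < C ^ n := by positivity
    have e : a = C ^ n * (a / C ^ n) := by field_simp
    have h1 : a / C ^ n ≤ a₁ := by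
      rw [div_le_iff₀ hCn]
      rw [div_le_iff₀ ha₁] at hn2
      linarith
    have h2 : C * a₁ ≤ a / C ^ n := by
      rw [le_div_iff₀ hCn]
      rw [lt_div_iff₀ ha₁, pow_succ] at hn1
      linarith
    have h3 := hiter n (a / C ^ n) (by positivity) h1
    rw [← e] at h3
    refine h3.trans ?_
    have h4 : γ (a / C ^ n) ≤ γ a₁ := hmono (mem_Ici.2 (by positivity)) (mem_Ici.2 ha₁.le) h1
    have h5 : γ a₁ = B * (C * a₁) ^ 3 := by simp only [B]; field_simp
    calc (C ^ n) ^ 3 * γ (a / C ^ n) ≤ (C ^ n) ^ 3 * (B * (a / C ^ n) ^ 3) := by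
          rw [h5] at h4
          gcongr
          refine h4.trans ?_
          gcongr
      _ = B * a ^ 3 := by field_simp
  -- Using the squared inequality twice gives γ(C²a) ≤ M⁶γ(a)⁴/(C²a⁶). The cubic bound, squared,
  -- cancels a⁶ against two of the four factors γ(a).
  refine ⟨C * C, M ^ 6 * B ^ 2 / C ^ 2, a₁, by positivity, by positivity, ha₁, fun a ha => ?_⟩
  have hg := hpos a ha.1
  have hCa : C * a ≤ a := by nlinarith [ha.1]
  have hCa0 : 0 < C * a := mul_pos hC ha.1
  have hg1 := hpos _ hCa0
  have s1 := hsq a ⟨ha.1, ha.2.trans ha₁₀⟩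
  have s2 := hsq (C * a) ⟨hCa0, (hCa.trans_lt ha.2).trans ha₁₀⟩
  have s3 := hcube a ha.1 ha.2.le
  have ha0 := ha.1
  rw [← mul_assoc] at s2
  have s4 : γ (C * a) ≤ M ^ 2 * γ a ^ 2 / a ^ 2 := by
    rw [le_div_iff₀ (by positivity)]; linarith
  have s5 : γ (C * C * a) ≤ M ^ 2 * γ (C * a) ^ 2 / (C * a) ^ 2 := by
    rw [le_div_iff₀ (by positivity)]; linarith
  calc γ (C * C * a) ≤ M ^ 2 * γ (C * a) ^ 2 / (C * a) ^ 2 := s5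
    _ ≤ M ^ 2 * (M ^ 2 * γ a ^ 2 / a ^ 2) ^ 2 / (C * a) ^ 2 := by gcongr
    _ = M ^ 6 / C ^ 2 / a ^ 6 * γ a ^ 2 * γ a ^ 2 := by field_simp
    _ ≤ M ^ 6 / C ^ 2 / a ^ 6 * (B * a ^ 3) ^ 2 * γ a ^ 2 := by gcongr
    _ = _ := by field_simp

end Gauge

/-! ### Covering and dyadic summation -/

/-- Greedy covering: starting at `r`, repeatedly step from s to s + y(s) until 2r is passed. Each
step has mass at most K y(2r) times its length, so the masses telescope. The last step overshoots by
at most y(2r) ≤ 2r, whence the factor 3. Every step is at least y(r) long, so finitely many suffice.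
-/
theorem measure_Ioc_two_mul_le {μ : Measure ℝ} {y : ℝ → ℝ} {K r : ℝ} (hr : 0 < r)
    (hy : MonotoneOn y (Ioi 0)) (hy0 : ∀ s, 0 < s → 0 < y s) (hyr : y (2 * r) ≤ 2 * r)
    (hK : 0 ≤ K)
    (hμ : ∀ s ∈ Icc r (2 * r), μ (Ioc s (s + y s)) ≤ ENNReal.ofReal (K * y s ^ 2)) :
    μ (Ioc r (2 * r)) ≤ ENNReal.ofReal (3 * K * r * y (2 * r)) := by
  have hY := hy0 (2 * r) (by linarith)
  have hyr0 := hy0 r hr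
  have key : ∀ n : ℕ, ∃ s, r ≤ s ∧ s ≤ 2 * r + y (2 * r) ∧ min (2 * r) (r + n * y r) ≤ s ∧
      μ (Ioc r s) ≤ ENNReal.ofReal (K * y (2 * r) * (s - r)) := fun n => by
    induction n with
    | zero => exact ⟨r, le_rfl, by linarith, by simp, by simp⟩
    | succ n ih =>
      obtain ⟨s, h1, h2, h3, h4⟩ := ih
      rcases le_or_gt s (2 * r) with hs | hs
      · have hs0 : 0 < s := hr.trans_le h1
        have e1 : y s ≤ y (2 * r) := hy hs0 (mem_Ioi.2 (by linarith)) hs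
        have e2 : y r ≤ y s := hy hr hs0 h1
        have e3 := hy0 s hs0
        refine ⟨s + y s, by linarith, by linarith, ?_, ?_⟩
        · push_cast
          rcases min_le_iff.1 h3 with h | h
          · exact (min_le_left _ _).trans (by linarith)
          · exact (min_le_right _ _).trans (by linarith)
        · rw [← Ioc_union_Ioc_eq_Ioc h1 (by linarith : s ≤ s + y s)]
          refine (measure_union_le _ _).trans ((add_le_add h4 (hμ s ⟨h1, hs⟩)).trans ?_)
          rw [← ENNReal.ofReal_add (mul_nonneg (by positivity) (by linarith)) (by positivity)]
          refine ENNReal.ofReal_le_ofReal ?_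
          have : K * y s ^ 2 ≤ K * y (2 * r) * y s := by
            rw [sq, ← mul_assoc]; gcongr
          linarith
      · exact ⟨s, h1, h2, (min_le_left _ _).trans hs.le, h4⟩
  obtain ⟨n, hn⟩ := exists_nat_ge (r / y r)
  obtain ⟨s, h1, h2, h3, h4⟩ := key n
  have h5 : 2 * r ≤ s := by
    rw [div_le_iff₀ hyr0] at hn
    rwa [min_eq_left (by linarith)] at h3
  refine (measure_mono (Ioc_subset_Ioc_right h5)).trans (h4.trans (ENNReal.ofReal_le_ofReal ?_))
  calc K * y (2 * r) * (s - r) ≤ K * y (2 * r) * (3 * r) := by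
        gcongr; linarith
    _ = _ := by ring

/-- On the block (r, 2r] monotonicity gives y(2t) ≥ y(2r), which is why the argument is doubled. The
factor y(2r) in the mass of the block then cancels, leaving O(r), and the radii are geometric. -/
theorem exists_lintegral_Ioc_lt_top {μ : Measure ℝ} {y : ℝ → ℝ} {K δ A : ℝ} (hδ : 0 < δ)
    (hy : MonotoneOn y (Ioi 0)) (hy0 : ∀ s, 0 < s → 0 < y s) (hys : ∀ s ∈ Ioo 0 δ, y s ≤ s)
    (hK : 0 ≤ K) (hA : 0 ≤ A)
    (hμ : ∀ s ∈ Ioo 0 δ, μ (Ioc s (s + y s)) ≤ ENNReal.ofReal (K * y s ^ 2))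
    {g : ℝ → ENNReal} (hg : ∀ t, 0 < t → g t ≤ ENNReal.ofReal (A / y (2 * t))) :
    ∫⁻ t in Ioc 0 (δ / 2), g t ∂μ < ⊤ := by
  set r : ℕ → ℝ := fun n => δ / 2 * (1 / 2) ^ (n + 1) with hr
  have hr0 : ∀ n, 0 < r n := fun n => by positivity
  have hr2 : ∀ n, 2 * r n = δ / 2 * (1 / 2) ^ n := fun n => by simp only [hr, pow_succ]; ring
  have hr3 : ∀ n, 2 * r n < δ := fun n => by
    have : (1 / 2 : ℝ) ^ n ≤ 1 := pow_le_one₀ (by norm_num) (by norm_num)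
    rw [hr2]
    nlinarith
  have hpiece : ∀ n, ∫⁻ t in Ioc (r n) (2 * r n), g t ∂μ ≤ ENNReal.ofReal (3 * K * A * r n) :=
    fun n => by
    have hrn := hr0 n
    have hyn := hy0 (2 * r n) (by linarith)
    have h1 : ∀ t ∈ Ioc (r n) (2 * r n), g t ≤ ENNReal.ofReal (A / y (2 * r n)) := fun t ht => by
      have ht0 : 0 < t := hrn.trans ht.1
      refine (hg t ht0).trans (ENNReal.ofReal_le_ofReal ?_)
      have : y (2 * r n) ≤ y (2 * t) :=
        hy (mem_Ioi.2 (by linarith)) (mem_Ioi.2 (by linarith)) (by linarith [ht.1])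
      gcongr
    refine (setLIntegral_mono measurable_const h1).trans ?_
    rw [setLIntegral_const]
    refine (mul_le_mul_right (measure_Ioc_two_mul_le hrn hy hy0 (hys _ ⟨by linarith, hr3 n⟩) hK
      fun s hs => hμ s ⟨hrn.trans_le hs.1, hs.2.trans_lt (hr3 n)⟩) _).trans ?_
    rw [← ENNReal.ofReal_mul (by positivity)]
    refine ENNReal.ofReal_le_ofReal (le_of_eq ?_)
    field_simp
  have hcov : Ioc 0 (δ / 2) ⊆ ⋃ n, Ioc (r n) (2 * r n) := fun t ht => by
    obtain ⟨n, hn1, hn2⟩ := exists_nat_pow_near_of_lt_one (x := t / (δ / 2)) (y := (1 / 2 : ℝ))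
      (div_pos ht.1 (by linarith)) ((div_le_one (by linarith)).2 ht.2) (by norm_num) (by norm_num)
    rw [lt_div_iff₀ (by linarith), mul_comm] at hn1
    rw [div_le_iff₀ (by linarith), mul_comm] at hn2
    exact mem_iUnion.2 ⟨n, hn1, by rw [hr2]; exact hn2⟩
  calc ∫⁻ t in Ioc 0 (δ / 2), g t ∂μ ≤ ∫⁻ t in ⋃ n, Ioc (r n) (2 * r n), g t ∂μ :=
        lintegral_mono_set hcov
    _ ≤ ∑' n, ∫⁻ t in Ioc (r n) (2 * r n), g t ∂μ := lintegral_iUnion_le _ _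
    _ ≤ ∑' n, ENNReal.ofReal (3 * K * A * r n) := ENNReal.tsum_le_tsum hpiece
    _ < ⊤ := by
      refine Summable.tsum_ofReal_lt_top ?_
      refine Summable.mul_left _ (Summable.mul_left _ ?_)
      exact (summable_nat_add_iff 1).2 (summable_geometric_of_lt_one (by norm_num) (by norm_num))

/-- If the balls of radius `y(|s|)` about `s` have measure `O(y(|s|)²)` then functions dominated by
`1 / y(2|t|)` are integrable near `0`. -/
theorem exists_lintegral_Ioo_lt_top {μ : Measure ℝ} {y : ℝ → ℝ} {K δ A : ℝ} (hδ : 0 < δ)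
    (hy : MonotoneOn y (Ioi 0)) (hy0 : ∀ s, 0 < s → 0 < y s) (hys : ∀ s ∈ Ioo 0 δ, y s ≤ s)
    (hK : 0 ≤ K) (hA : 0 ≤ A) (h0 : μ {0} = 0)
    (hμ : ∀ s : ℝ, 0 < |s| → |s| < δ →
      μ (Metric.closedBall s (y |s|)) ≤ ENNReal.ofReal (K * y |s| ^ 2))
    {g : ℝ → ENNReal} (hg : ∀ t, t ≠ 0 → g t ≤ ENNReal.ofReal (A / y (2 * |t|))) :
    ∃ δ' : ℝ, 0 < δ' ∧ ∫⁻ t in Ioo (-δ') δ', g t ∂μ < ⊤ := by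
  refine ⟨δ / 2, by positivity, ?_⟩
  have hp : ∫⁻ t in Ioc 0 (δ / 2), g t ∂μ < ⊤ := by
    refine exists_lintegral_Ioc_lt_top hδ hy hy0 hys hK hA (fun s hs => ?_) (fun t ht => ?_)
    · have := hμ s (abs_pos.2 hs.1.ne') (by rw [abs_of_pos hs.1]; exact hs.2)
      rw [abs_of_pos hs.1] at this
      refine (measure_mono ?_).trans this
      rw [Real.closedBall_eq_Icc]
      exact fun t ht => ⟨by linarith [ht.1, hy0 s hs.1], ht.2⟩
    · simpa [abs_of_pos ht] using hg t ht.ne'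
  -- The negative side follows from the positive one by reflecting the measure.
  have hn : ∫⁻ t in Ioc 0 (δ / 2), g (-t) ∂(μ.map Neg.neg) < ⊤ := by
    refine exists_lintegral_Ioc_lt_top hδ hy hy0 hys hK hA (fun s hs => ?_) (fun t ht => ?_)
    · have := hμ (-s) (abs_pos.2 (neg_ne_zero.2 hs.1.ne'))
        (by rw [abs_neg, abs_of_pos hs.1]; exact hs.2)
      rw [abs_neg, abs_of_pos hs.1] at this
      rw [Measure.map_apply measurable_neg measurableSet_Ioc]
      refine (measure_mono ?_).trans this
      rw [Real.closedBall_eq_Icc]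
      exact fun t ht => ⟨by linarith [ht.2], by linarith [ht.1, hy0 s hs.1]⟩
    · simpa [abs_of_pos ht] using hg (-t) (neg_ne_zero.2 ht.ne')
  have hemb : MeasurableEmbedding (Neg.neg : ℝ → ℝ) := (MeasurableEquiv.neg ℝ).measurableEmbedding
  rw [hemb.restrict_map, hemb.lintegral_map] at hn
  simp only [neg_neg] at hn
  have hsub : Ioo (-(δ / 2)) (δ / 2) ⊆
      (Neg.neg ⁻¹' Ioc 0 (δ / 2) ∪ {0}) ∪ Ioc 0 (δ / 2) := fun t ht => by
    rcases lt_trichotomy t 0 with h | h | h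
    · exact Or.inl (Or.inl ⟨by linarith, by linarith [ht.1]⟩)
    · exact Or.inl (Or.inr h)
    · exact Or.inr ⟨h, ht.2.le⟩
  refine (lintegral_mono_set hsub).trans_lt ((lintegral_union_le _ _ _).trans_lt ?_)
  refine ENNReal.add_lt_top.2 ⟨(lintegral_union_le _ _ _).trans_lt
    (ENNReal.add_lt_top.2 ⟨hn, ?_⟩), hp⟩
  rw [setLIntegral_measure_zero _ _ h0]
  exact ENNReal.zero_lt_top

/-! ### From regularity to the Stolz region -/

theorem ofReal_div_le_mul_inv {y A n g : ℝ} (hy : 0 < y) (hA : 0 < A) (hn : 0 < n)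
    (h : g ≤ A * n ^ 2) :
    ENNReal.ofReal (y / (Real.pi * n ^ 2)) ≤
      ENNReal.ofReal (y * A / Real.pi) * (ENNReal.ofReal g)⁻¹ := by
  have hpi := Real.pi_pos
  rcases le_or_gt g 0 with hg | hg
  · rw [ENNReal.ofReal_of_nonpos hg, ENNReal.inv_zero, ENNReal.mul_top]
    · exact le_top
    · rw [Ne, ENNReal.ofReal_eq_zero, not_le]; positivity
  · rw [← ENNReal.ofReal_inv_of_pos hg, ← ENNReal.ofReal_mul (by positivity)]
    refine ENNReal.ofReal_le_ofReal ?_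
    rw [← div_eq_mul_inv, div_div, div_le_div_iff₀ (by positivity) (by positivity)]
    calc y * (Real.pi * g) ≤ y * (Real.pi * (A * n ^ 2)) := by gcongr
      _ = _ := by ring

/-- At a point of `γ`-regularity `Im f / Im` is bounded on all sets where the kernel
`1 / |t - w|²` is dominated by `1 / γ(C|t - σ|)`. -/
theorem GammaRegularAt.exists_im_le {γ : ℝ → ℝ} {f : ℂ → ℂ} {σ : ℝ}
    (hf : DifferentiableOn ℂ f upperPlane) (hpos : ∀ w ∈ upperPlane, 0 ≤ (f w).im)
    (hreg : GammaRegularAt γ f σ) :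
    ∃ C δ : ℝ, 0 < C ∧ 0 < δ ∧ ∀ δ₁ A : ℝ, 0 < δ₁ → δ₁ ≤ δ → 0 < A → ∃ Q : ℝ, 0 ≤ Q ∧
      ∀ w ∈ upperPlane, ‖w - σ‖ ≤ δ₁ / 2 →
        (∀ t : ℝ, |t - σ| < δ₁ → γ (C * |t - σ|) ≤ A * ‖(t : ℂ) - w‖ ^ 2) →
        (f w).im ≤ Q * w.im := by
  obtain ⟨μ, hμ, C, hC, δ, hδ, hint⟩ := hreg
  obtain ⟨b, μ', hb, hμ', hfin, hrep⟩ := exists_isNevanlinnaMeasure hf hpos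
  obtain rfl := hμ.unique hμ'
  have hpi := Real.pi_pos
  refine ⟨C, δ, hC, hδ, fun δ₁ A hδ₁ hδδ hA => ?_⟩
  set I₁ := ∫⁻ t in Ioo (σ - δ) (σ + δ), (ENNReal.ofReal (γ (C * |t - σ|)))⁻¹ ∂μ
  set I₂ := ∫⁻ t : ℝ, ENNReal.ofReal ((1 + t ^ 2)⁻¹) ∂μ
  -- Chosen so that 1 + t² ≤ L(t - σ)² for |t - σ| ≥ δ₁, by t² ≤ 2σ² + 2(t - σ)². This makes the far
  -- part of the Poisson integral O(Im w), through ∫ dμ/(1 + t²).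
  set L := (1 + 2 * σ ^ 2) / δ₁ ^ 2 + 2 with hL
  have hL0 : 0 < L := by positivity
  refine ⟨b + A / Real.pi * I₁.toReal + 4 * L / Real.pi * I₂.toReal, by positivity,
    fun w hw hwσ hdom => ?_⟩
  have hy : 0 < w.im := hw
  set s := Ioo (σ - δ₁) (σ + δ₁)
  have hs : MeasurableSet s := measurableSet_Ioo
  have hmem : ∀ t, t ∈ s ↔ |t - σ| < δ₁ := fun t => by
    rw [abs_lt]
    exact ⟨fun h => ⟨by linarith [h.1], by linarith [h.2]⟩,
      fun h => ⟨by linarith [h.1], by linarith [h.2]⟩⟩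
  have hnear : ∫⁻ t in s, ENNReal.ofReal (w.im / (Real.pi * ‖(t : ℂ) - w‖ ^ 2)) ∂μ ≤
      ENNReal.ofReal (w.im * A / Real.pi) * I₁ := by
    calc _ ≤ ∫⁻ t in s, ENNReal.ofReal (w.im * A / Real.pi) *
          (ENNReal.ofReal (γ (C * |t - σ|)))⁻¹ ∂μ :=
          setLIntegral_mono' hs fun t ht =>
            ofReal_div_le_mul_inv hy hA (norm_ofReal_sub_pos hy t) (hdom t ((hmem t).1 ht))
      _ = ENNReal.ofReal (w.im * A / Real.pi) *
          ∫⁻ t in s, (ENNReal.ofReal (γ (C * |t - σ|)))⁻¹ ∂μ :=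
          lintegral_const_mul' _ _ ENNReal.ofReal_ne_top
      _ ≤ _ := by
          gcongr
          exact lintegral_mono_set (Ioo_subset_Ioo (by linarith) (by linarith))
  have hfar : ∫⁻ t in sᶜ, ENNReal.ofReal (w.im / (Real.pi * ‖(t : ℂ) - w‖ ^ 2)) ∂μ ≤
      ENNReal.ofReal (w.im * (4 * L / Real.pi)) * I₂ := by
    calc _ ≤ ∫⁻ t in sᶜ, ENNReal.ofReal (w.im * (4 * L / Real.pi)) *
          ENNReal.ofReal ((1 + t ^ 2)⁻¹) ∂μ := by
          refine setLIntegral_mono' hs.compl fun t ht => ?_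
          have ht' : δ₁ ≤ |t - σ| := not_lt.1 fun h => ht ((hmem t).2 h)
          rw [← ENNReal.ofReal_mul (by positivity)]
          refine ENNReal.ofReal_le_ofReal ?_
          have h1 : |t - σ| / 2 ≤ ‖(t : ℂ) - w‖ := by
            have h2 : |t - σ| ≤ ‖(t : ℂ) - w‖ + ‖w - σ‖ := by
              rw [← Real.norm_eq_abs, ← Complex.norm_real]
              push_cast
              exact norm_sub_le_norm_sub_add_norm_sub _ _ _
            linarith
          have h3 : (t - σ) ^ 2 ≤ 4 * ‖(t : ℂ) - w‖ ^ 2 := by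
            rw [← sq_abs (t - σ)]
            nlinarith [abs_nonneg (t - σ)]
          have h4 : δ₁ ^ 2 ≤ (t - σ) ^ 2 := by
            rw [← sq_abs (t - σ)]; gcongr
          have h5 : 1 + t ^ 2 ≤ L * (t - σ) ^ 2 := by
            have : (1 + 2 * σ ^ 2) ≤ (1 + 2 * σ ^ 2) / δ₁ ^ 2 * (t - σ) ^ 2 := by
              rw [div_mul_eq_mul_div, le_div_iff₀ (by positivity)]
              gcongr
            rw [hL, add_mul]
            nlinarith [sq_nonneg (t - 2 * σ)]
          have hn := norm_ofReal_sub_pos hy t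
          rw [← div_eq_mul_inv, div_le_div_iff₀ (by positivity) (by positivity)]
          have h6 : w.im * (4 * L / Real.pi) * (Real.pi * ‖(t : ℂ) - w‖ ^ 2) =
              w.im * (L * (4 * ‖(t : ℂ) - w‖ ^ 2)) := by
            field_simp
          rw [h6]
          gcongr
          exact h5.trans (by gcongr)
      _ = ENNReal.ofReal (w.im * (4 * L / Real.pi)) *
          ∫⁻ t in sᶜ, ENNReal.ofReal ((1 + t ^ 2)⁻¹) ∂μ :=
          lintegral_const_mul' _ _ ENNReal.ofReal_ne_top
      _ ≤ _ := by
          gcongr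
          exact setLIntegral_le_lintegral _ _
  have htot := hrep w hw
  rw [← lintegral_add_compl _ hs] at htot
  have hle : ENNReal.ofReal (f w).im ≤ ENNReal.ofReal (b * w.im) +
      (ENNReal.ofReal (w.im * A / Real.pi) * I₁ +
        ENNReal.ofReal (w.im * (4 * L / Real.pi)) * I₂) := by
    rw [htot]
    gcongr
  rw [← ENNReal.ofReal_toReal hint.ne, ← ENNReal.ofReal_toReal hfin.ne,
    ← ENNReal.ofReal_mul (by positivity), ← ENNReal.ofReal_mul (by positivity),
    ← ENNReal.ofReal_add (by positivity) (by positivity),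
    ← ENNReal.ofReal_add (by positivity) (by positivity),
    ENNReal.ofReal_le_ofReal_iff (by positivity)] at hle
  refine hle.trans (le_of_eq ?_)
  simp only [I₁, I₂]
  ring

theorem juliaQuotient_unitDisk {φ : ℂ → ℂ} {z : ℂ} (hz : z ∈ unitDisk) (hφz : ‖φ z‖ ≤ 1) :
    juliaQuotient unitDisk unitDisk φ z = (1 - ‖φ z‖) / (1 - ‖z‖) := by
  rw [juliaQuotient, infDist_frontier_unitDisk hφz,
    infDist_frontier_unitDisk (mem_unitDisk.1 hz).le]

theorem norm_cayleyAt_sub_cayleyAt {a u w : ℂ} (ha : 0 < a.im) (hu : 0 ≤ u.im) (hw : 0 ≤ w.im) :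
    ‖cayleyAt a w - cayleyAt a u‖ = 2 * a.im * ‖w - u‖ / (‖w - conj a‖ * ‖u - conj a‖) := by
  have h1 := sub_conj_ne_zero ha hw
  have h2 := sub_conj_ne_zero ha hu
  have e : cayleyAt a w - cayleyAt a u =
      (a - conj a) * (w - u) / ((w - conj a) * (u - conj a)) := by
    rw [cayleyAt, cayleyAt, div_sub_div _ _ h1 h2]
    congr 1
    ring
  rw [e, norm_div, norm_mul, norm_mul]
  congr 2
  rw [Complex.sub_conj, norm_mul, Complex.norm_I, mul_one, Complex.norm_real, Real.norm_eq_abs,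
    abs_of_pos (by linarith)]

/-- A rotated Cayley transform maps Stolz regions into regions where the kernel `1 / |t - w|²` is
dominated by `1 / γ`. -/
theorem kernel_bound_of_stolz {γ : ℝ → ℝ} (hmono : MonotoneOn γ (Ici 0)) {C K₀ K₁ k s d c y n v : ℝ}
    (hC : 0 < C) (hK₀ : 0 ≤ K₀) (hK₁ : 0 < K₁) (hk : 0 < k) (hs : 0 ≤ s)
    (hγ : γ (C * s) ≤ K₀ * s ^ 2) (hc : 0 < c) (hd : 0 ≤ d) (hdγ : γ (4 * K₁ * C * c) ≤ d ^ 2)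
    (hdy : d ≤ k * y) (hyn : y ≤ n) (hn : 0 < n) (hv : v ≤ K₁ * (c + d)) (hsn : s ≤ n + v) :
    γ (C * s) ≤ (4 * K₀ + K₀ * (4 * K₁ * k) ^ 2 + k ^ 2) * n ^ 2 := by
  have h0 : 0 ≤ 4 * K₀ * n ^ 2 := by positivity
  have h1 : 0 ≤ K₀ * (4 * K₁ * k) ^ 2 * n ^ 2 := by positivity
  have h2 : 0 ≤ k ^ 2 * n ^ 2 := by positivity
  have hdn : d ≤ k * n := hdy.trans (by gcongr)
  -- If s ≥ 2v, then n is comparable to s and the quadratic growth of `γ` suffices. Otherwise s is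
  -- at most 2v: for c ≤ d this is O(n), and for c > d the Stolz condition on d takes over by
  -- monotonicity.
  rcases le_or_gt (2 * v) s with hsv | hsv
  · have h3 : s ≤ 2 * n := by linarith
    have h4 : K₀ * s ^ 2 ≤ K₀ * (2 * n) ^ 2 := by gcongr
    nlinarith
  · rcases le_or_gt c d with hcd | hcd
    · have h3 : s ≤ 4 * K₁ * k * n := by
        have : K₁ * (c + d) ≤ K₁ * (2 * (k * n)) := by gcongr; linarith
        linarith
      have h4 : K₀ * s ^ 2 ≤ K₀ * (4 * K₁ * k * n) ^ 2 := by gcongr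
      nlinarith
    · have h3 : C * s ≤ 4 * K₁ * C * c := by
        have : K₁ * (c + d) ≤ K₁ * (2 * c) := by gcongr; linarith
        have : s ≤ 4 * K₁ * c := by linarith
        calc C * s ≤ C * (4 * K₁ * c) := by gcongr
          _ = _ := by ring
      have h4 : γ (C * s) ≤ γ (4 * K₁ * C * c) :=
        hmono (mem_Ici.2 (by positivity)) (mem_Ici.2 (by positivity)) h3
      have h5 : d ^ 2 ≤ (k * n) ^ 2 := by gcongr
      nlinarith

/-- Near a boundary point the Cayley transform changes distances, and distances to the boundary, by
bounded factors. -/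
theorem cayleyAt_estimates {a : ℂ} (ha : 0 < a.im) (σ : ℝ) :
    ∃ K k L ε : ℝ, 0 < K ∧ 0 < k ∧ 0 < L ∧ 0 < ε ∧ ∀ w ∈ upperPlane,
      ‖cayleyAt a w - cayleyAt a σ‖ < ε →
        ‖w - σ‖ ≤ K * ‖cayleyAt a w - cayleyAt a σ‖ ∧ 1 - ‖cayleyAt a w‖ ≤ k * w.im ∧
          w.im ≤ L * (1 - ‖cayleyAt a w‖) := by
  set α := a.im with hα
  set B := ‖(σ : ℂ) - conj a‖ with hB
  have hαB : α ≤ B := im_le_norm_sub_conj (by simp)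
  have hB0 : 0 < B := ha.trans_le hαB
  -- With r ≤ α/B the term rBV is absorbed into 2αV = rNB, giving V ≤ (B²/α)r. With r ≤ α/B² this
  -- makes V ≤ 1, hence N ≤ B + 1.
  refine ⟨B ^ 2 / α, 4 / α, (B + 1) ^ 2 / (2 * α), min (1 / (B ^ 2 / α)) (α / B), by positivity,
    by positivity, by positivity, by positivity, fun w hw hε => ?_⟩
  have hy : 0 < w.im := hw
  have hzτ := norm_cayleyAt_sub_cayleyAt (u := (σ : ℂ)) ha (by simp) hy.le
  have hd2 := one_sub_norm_cayleyAt ha hy.le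
  have hz1 := norm_cayleyAt_lt_one ha hy
  rw [← hB, ← hα] at hzτ
  rw [← hα] at hd2
  set N := ‖w - conj a‖ with hN
  have hNα : α ≤ N := im_le_norm_sub_conj hy.le
  have hN0 : 0 < N := ha.trans_le hNα
  set V := ‖w - σ‖ with hV
  have hV0 : 0 ≤ V := norm_nonneg _
  have hNV : N ≤ V + B := by
    rw [hN, hV, hB]
    exact norm_sub_le_norm_sub_add_norm_sub _ _ _
  set r := ‖cayleyAt a w - cayleyAt a σ‖ with hr
  have hr0 : 0 ≤ r := norm_nonneg _
  set q := ‖cayleyAt a w‖ with hq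
  have hq0 : 0 ≤ q := norm_nonneg _
  clear_value α B N V r q
  rw [eq_div_iff (by positivity)] at hzτ
  rw [eq_div_iff (by positivity)] at hd2
  have hVr : V ≤ B ^ 2 / α * r := by
    have h1 : r * B ≤ α := by
      have : r ≤ α / B := hε.le.trans (min_le_right _ _)
      rwa [le_div_iff₀ hB0] at this
    have h2 : r * (N * B) ≤ r * B * V + r * B ^ 2 := by
      calc r * (N * B) ≤ r * ((V + B) * B) := by gcongr
        _ = _ := by ring
    have h3 : r * B * V ≤ α * V := by gcongr
    rw [div_mul_eq_mul_div, le_div_iff₀ ha]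
    linarith
  have hNB : N ≤ B + 1 := by
    have : r ≤ 1 / (B ^ 2 / α) := hε.le.trans (min_le_left _ _)
    rw [le_div_iff₀ (by positivity)] at this
    linarith
  refine ⟨hVr, ?_, ?_⟩
  · have h1 : (1 - q) * α * α ≤ 4 * w.im * α := by
      calc (1 - q) * α * α = (1 - q) * α ^ 2 := by ring
        _ ≤ (1 - q ^ 2) * N ^ 2 := by
          have : 1 - q ≤ 1 - q ^ 2 := by nlinarith
          have : 0 ≤ 1 - q := by linarith
          gcongr
          linarith
        _ = _ := by rw [hd2]; ring
    have h2 := le_of_mul_le_mul_right h1 ha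
    rw [div_mul_eq_mul_div, le_div_iff₀ ha]
    exact h2
  · rw [div_mul_eq_mul_div, le_div_iff₀ (by positivity)]
    have h3 : 1 - q ^ 2 ≤ 2 * (1 - q) := by nlinarith
    have : (1 - q ^ 2) * N ^ 2 ≤ 2 * (1 - q) * (B + 1) ^ 2 := by
      have : 0 ≤ 2 * (1 - q) := by linarith
      gcongr
    linarith

theorem kernel_growth {γ : ℝ → ℝ} (hmono : MonotoneOn γ (Ici 0)) (hnonneg : 0 ≤ γ 0)
    (hO : γ =O[𝓝[>] 0] fun t : ℝ => t ^ 2) {C : ℝ} (hC : 0 < C) :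
    ∃ K δ : ℝ, 0 ≤ K ∧ 0 < δ ∧ ∀ s, 0 ≤ s → s < δ → γ (C * s) ≤ K * s ^ 2 := by
  obtain ⟨k₀, hk₀⟩ := hO.bound
  obtain ⟨δ₀, hδ₀, hsub⟩ := mem_nhdsGT_iff_exists_Ioo_subset.1 hk₀
  have hδ₀' : (0 : ℝ) < δ₀ := hδ₀
  -- The growth hypothesis says nothing at `0` itself, so the case s = 0 needs the value forced by
  -- monotonicity.
  have hγ0 : γ 0 = 0 := by
    refine le_antisymm (ge_of_tendsto (tendsto_zero_of_isBigO_sq hO) ?_) hnonneg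
    filter_upwards [self_mem_nhdsWithin] with t ht
    exact hmono self_mem_Ici (mem_Ici.2 (le_of_lt ht)) (le_of_lt ht)
  refine ⟨|k₀| * C ^ 2, δ₀ / C, by positivity, by positivity, fun s hs hs1 => ?_⟩
  rcases hs.eq_or_lt with h | h
  · simp [← h, hγ0]
  · have h1 : C * s ∈ Ioo 0 δ₀ := by
      refine ⟨by positivity, ?_⟩
      rw [lt_div_iff₀ hC] at hs1
      linarith
    have h2 := hsub h1
    simp only [mem_ofPred_eq, Real.norm_eq_abs] at h2
    calc γ (C * s) ≤ |γ (C * s)| := le_abs_self _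
      _ ≤ k₀ * |(C * s) ^ 2| := h2
      _ ≤ |k₀| * |(C * s) ^ 2| := by gcongr; exact le_abs_self _
      _ = _ := by rw [abs_of_nonneg (sq_nonneg (C * s))]; ring

theorem exists_stolz_bound_of_transformGammaRegularAt {γ : ℝ → ℝ} (hmono : MonotoneOn γ (Ici 0))
    (hnonneg : 0 ≤ γ 0) (hO : γ =O[𝓝[>] 0] fun t : ℝ => t ^ 2) {φ : ℂ → ℂ}
    (hφ : DifferentiableOn ℂ φ unitDisk) (hφmaps : MapsTo φ unitDisk (closure unitDisk)) {τ : ℂ}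
    (h : TransformGammaRegularAt unitDisk unitDisk γ φ τ) :
    ∃ C D : ℝ, 0 < C ∧ 0 < D ∧ ∃ K : ℝ,
      ∀ᶠ z in 𝓝[stolzRegion unitDisk (fun t : ℝ => √(D * γ (C * t))) τ] τ,
        juliaQuotient unitDisk unitDisk φ z ≤ K := by
  rcases mapsTo_unitDisk_or_const hφ hφmaps with hm | ⟨c, hc, hφc⟩
  swap
  · refine ⟨1, 1, one_pos, one_pos, 0, ?_⟩
    filter_upwards [self_mem_nhdsWithin] with z hz
    rw [juliaQuotient_unitDisk hz.1 (by rw [hφc z hz.1, hc]), hφc z hz.1, hc]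
    simp
  obtain ⟨ψ, χ, σ, hχ, hχτ, hψ, -, hreg⟩ := h
  obtain ⟨a, e, ha, he, hχe⟩ := hχ.eq_cayleyAt
  have hFd : DifferentiableOn ℂ (fun w => ψ (φ (χ w))) upperPlane :=
    hψ.1.comp (hφ.comp hχ.1 hχ.2.mapsTo) (hm.comp hχ.2.mapsTo)
  have hFm : ∀ w ∈ upperPlane, 0 ≤ (ψ (φ (χ w))).im := fun w hw =>
    le_of_lt (hψ.2.mapsTo (hm (hχ.2.mapsTo hw)))
  obtain ⟨C, δ, hC, hδ, hbound⟩ := hreg.exists_im_le hFd hFm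
  -- the value of `χ` at `σ`
  have hτ : τ = e * cayleyAt a σ := by
    have hσ : (σ : ℂ) - conj a ≠ 0 := sub_conj_ne_zero ha (by simp)
    have c1 : ContinuousAt (fun w => e * cayleyAt a w) (σ : ℂ) := by
      unfold cayleyAt
      fun_prop (disch := assumption)
    have : (𝓝[upperPlane] (σ : ℂ)).NeBot := by
      rw [← mem_closure_iff_nhdsWithin_neBot]
      have : closure upperPlane = {z : ℂ | 0 ≤ z.im} := Complex.closure_setOfPred_lt_im 0
      rw [this]
      simp
    refine tendsto_nhds_unique hχτ ((c1.tendsto.mono_left nhdsWithin_le_nhds).congr' ?_)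
    filter_upwards [self_mem_nhdsWithin] with w hw using (hχe w hw).symm
  obtain ⟨K₁, k, L, ε, hK₁0, hk0, hL0, hε0, hest⟩ := cayleyAt_estimates ha σ
  obtain ⟨K₀, δ₀, hK₀, hδ₀, hγle⟩ := kernel_growth hmono hnonneg hO hC
  obtain ⟨Q, hQ0, hQ⟩ := hbound (min δ δ₀) (4 * K₀ + K₀ * (4 * K₁ * k) ^ 2 + k ^ 2) (by positivity)
    (min_le_left _ _) (by positivity)
  set p := (ψ 0).im with hp
  have hp0 : 0 < p := hψ.2.mapsTo (show (0 : ℂ) ∈ unitDisk by simp [unitDisk])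
  -- In the critical case s < 2v ≤ 2K₁(c + d) < 4K₁c, so the region must control `γ` at 4K₁Cc.
  refine ⟨4 * K₁ * C, 1, by positivity, one_pos, 4 / p * (Q * L), ?_⟩
  set ε' := min ε (min δ δ₀ / 2 / K₁) with hε'
  have hε'0 : 0 < ε' := by positivity
  have hnhds : ∀ᶠ z in 𝓝 τ, ‖z - τ‖ < ε' := by
    filter_upwards [Metric.ball_mem_nhds τ hε'0] with z hz
    rwa [← dist_eq_norm]
  filter_upwards [self_mem_nhdsWithin, nhdsWithin_le_nhds hnhds] with z hz hzε
  obtain ⟨hzD, c, hc, hcd, hdc⟩ := hz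
  have hz1 := mem_unitDisk.1 hzD
  rw [infDist_frontier_unitDisk hz1.le] at hcd hdc
  obtain ⟨w, hw, hwz⟩ := hχ.2.surjOn hzD
  have hy : 0 < w.im := hw
  have hz_eq : z = e * cayleyAt a w := by rw [← hwz, hχe w hw]
  have hnz : ‖z‖ = ‖cayleyAt a w‖ := by rw [hz_eq, norm_mul, he, one_mul]
  have hzτ : ‖z - τ‖ = ‖cayleyAt a w - cayleyAt a σ‖ := by
    rw [hτ, hz_eq, ← mul_sub, norm_mul, he, one_mul]
  obtain ⟨hVr, hdy, hyd⟩ := hest w hw (by rw [← hzτ]; exact hzε.trans_le (min_le_left _ _))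
  rw [← hzτ] at hVr
  rw [← hnz] at hdy hyd
  have hVδ : ‖w - σ‖ ≤ min δ δ₀ / 2 := by
    have : ‖z - τ‖ ≤ min δ δ₀ / 2 / K₁ := hzε.le.trans (min_le_right _ _)
    rw [le_div_iff₀ hK₁0] at this
    linarith
  set d := 1 - ‖z‖ with hd
  have hd0 : 0 < d := by linarith
  have hrcd : ‖z - τ‖ ≤ c + d := by
    rw [dist_eq_norm, Real.sqrt_le_left hc.le] at hdc
    nlinarith
  have hγd : γ (4 * K₁ * C * c) ≤ d ^ 2 := by
    beta_reduce at hcd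
    rw [one_mul] at hcd
    exact (Real.sqrt_le_left hd0.le).1 hcd
  have him := hQ w hw hVδ fun t ht => by
    have hn := norm_ofReal_sub_pos hy t
    refine kernel_bound_of_stolz hmono (y := w.im) (v := ‖w - σ‖) (d := d) (c := c) hC hK₀
      hK₁0 hk0 (abs_nonneg _) (hγle _ (abs_nonneg _) (ht.trans_le (min_le_right _ _))) hc hd0.le hγd hdy ?_ hn
      (hVr.trans (by gcongr)) ?_
    · have := Complex.abs_im_le_norm ((t : ℂ) - w)
      simpa [abs_of_pos hy] using this
    · rw [← Real.norm_eq_abs, ← Complex.norm_real]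
      push_cast
      exact norm_sub_le_norm_sub_add_norm_sub _ _ _
  simp only [hwz] at him
  have hhopf := one_sub_norm_le_im hψ.1 hψ.2.mapsTo (hm hzD)
  rw [juliaQuotient_unitDisk hzD (mem_unitDisk.1 (hm hzD)).le, div_le_iff₀ hd0]
  have h1 : Q * w.im ≤ Q * (L * d) := by gcongr
  have h2 : p / 4 * (1 - ‖φ z‖) ≤ Q * (L * d) :=
    hhopf.trans (him.trans h1)
  calc 1 - ‖φ z‖ = 4 / p * (p / 4 * (1 - ‖φ z‖)) := by field_simp
    _ ≤ 4 / p * (Q * (L * d)) := by gcongr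
    _ = _ := by ring

/-! ### From the Stolz region to the curve -/

/-- The point of the disk with logarithmic polar coordinates `(-ρ, t)` relative to `τ`. -/
noncomputable def polarPoint (τ : ℂ) (ρ t : ℝ) : ℂ :=
  τ * Complex.exp (-(ρ : ℂ) + t * Complex.I)

theorem norm_polarPoint {τ : ℂ} (hτ : ‖τ‖ = 1) (ρ t : ℝ) :
    ‖polarPoint τ ρ t‖ = Real.exp (-ρ) := by
  rw [polarPoint, norm_mul, hτ, one_mul, Complex.norm_exp]
  simp

theorem polarPoint_mem {τ : ℂ} (hτ : ‖τ‖ = 1) {ρ : ℝ} (hρ : 0 < ρ) (t : ℝ) :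
    polarPoint τ ρ t ∈ unitDisk := by
  rw [mem_unitDisk, norm_polarPoint hτ]
  exact Real.exp_lt_one_iff.2 (by linarith)

/-- This is the radicand in the definition of a Stolz region. It is at most t², so |t| can serve as
the parameter c there. -/
theorem norm_polarPoint_sub_sq {τ : ℂ} (hτ : ‖τ‖ = 1) (ρ t : ℝ) :
    ‖polarPoint τ ρ t - τ‖ ^ 2 - (1 - ‖polarPoint τ ρ t‖) ^ 2 =
      2 * Real.exp (-ρ) * (1 - Real.cos t) := by
  have e : polarPoint τ ρ t - τ = τ * (Complex.exp (-(ρ : ℂ) + t * Complex.I) - 1) := by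
    rw [polarPoint]; ring
  have h1 : (Complex.exp (-(ρ : ℂ) + t * Complex.I)).re = Real.exp (-ρ) * Real.cos t := by
    rw [Complex.exp_re]; simp
  have h2 : (Complex.exp (-(ρ : ℂ) + t * Complex.I)).im = Real.exp (-ρ) * Real.sin t := by
    rw [Complex.exp_im]; simp
  rw [norm_polarPoint hτ, e, norm_mul, hτ, one_mul, ← Complex.normSq_eq_norm_sq,
    Complex.normSq_apply, Complex.sub_re, Complex.sub_im, h1, h2, Complex.one_re, Complex.one_im]
  linear_combination Real.exp (-ρ) ^ 2 * Real.sin_sq_add_cos_sq t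

theorem tendsto_gauge {γ : ℝ → ℝ} (hO : γ =O[𝓝[>] 0] fun t : ℝ => t ^ 2) {C : ℝ} (hC : 0 < C)
    (D : ℝ) : Tendsto (fun t : ℝ => D * γ (C * |t|)) (𝓝[≠] 0) (𝓝 0) := by
  have h : Tendsto (fun t : ℝ => C * |t|) (𝓝[≠] 0) (𝓝[>] 0) := by
    refine tendsto_nhdsWithin_iff.2 ⟨?_, ?_⟩
    · have : Continuous fun t : ℝ => C * |t| := by fun_prop
      simpa using (this.tendsto 0).mono_left nhdsWithin_le_nhds
    · filter_upwards [self_mem_nhdsWithin] with t ht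
      have : 0 < |t| := abs_pos.2 ht
      exact mem_Ioi.2 (by positivity)
  simpa using ((tendsto_zero_of_isBigO_sq hO).comp h).const_mul D

theorem tendsto_polarPoint {γ : ℝ → ℝ} (hO : γ =O[𝓝[>] 0] fun t : ℝ => t ^ 2) {C : ℝ}
    (hC : 0 < C) (D : ℝ) (τ : ℂ) :
    Tendsto (fun t : ℝ => polarPoint τ (D * γ (C * |t|)) t) (𝓝[≠] 0) (𝓝 τ) := by
  have h1 := (tendsto_gauge hO hC D).prodMk_nhds
    ((tendsto_id (α := ℝ) (x := 𝓝 0)).mono_left (nhdsWithin_le_nhds (s := {0}ᶜ)))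
  have h2 : Continuous fun p : ℝ × ℝ => polarPoint τ p.1 p.2 := by
    unfold polarPoint; fun_prop
  simpa [polarPoint, Function.comp_def] using (h2.tendsto (0, 0)).comp h1

theorem half_le_one_sub_exp_neg {ρ : ℝ} (h0 : 0 ≤ ρ) (h1 : ρ ≤ 1) :
    ρ / 2 ≤ 1 - Real.exp (-ρ) := by
  have h2 := Real.add_one_le_exp ρ
  have h3 : Real.exp (-ρ) ≤ 1 / (ρ + 1) := by
    rw [Real.exp_neg, ← one_div]
    gcongr
  have h4 : 1 / (ρ + 1) ≤ 1 - ρ / 2 := by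
    rw [div_le_iff₀ (by linarith)]
    nlinarith
  linarith

theorem limsup_lt_top_of_stolz_bound {γ : ℝ → ℝ} (hmono : MonotoneOn γ (Ici 0))
    (hpos : ∀ t : ℝ, 0 < t → 0 < γ t) (hO : γ =O[𝓝[>] 0] fun t : ℝ => t ^ 2)
    (haug : IsAugury γ hmono (fun t : ℝ => √(γ t))) (J : ℂ → ℝ) {τ : ℂ} (hτ : ‖τ‖ = 1)
    (h : ∃ C D : ℝ, 0 < C ∧ 0 < D ∧ ∃ K : ℝ,
      ∀ᶠ z in 𝓝[stolzRegion unitDisk (fun t : ℝ => √(D * γ (C * t))) τ] τ, J z ≤ K) :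
    ∃ C D : ℝ, 0 < C ∧ 0 < D ∧
      limsup (fun t : ℝ => ((J (polarPoint τ (D * γ (C * |t|)) t) : ℝ) : EReal)) (𝓝[≠] 0) < ⊤ := by
  obtain ⟨C, D, hC, hD, K, hK⟩ := h
  obtain ⟨κ, k, a₀, hκ, hk, ha₀, hγ⟩ := haug.exists_le_sq hmono hpos hO
  have hC' : 0 < C / κ := by positivity
  have hD' : 0 < 2 * √(D * k) := by positivity
  -- The argument is divided by κ to match γ(κa) ≤ kγ(a)². The factor 2 pays for 1 - exp(-ρ) ≥ ρ/2.
  refine ⟨C / κ, 2 * √(D * k), hC', hD', ?_⟩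
  refine (limsup_le_of_le (a := ((K : ℝ) : EReal)) (by isBoundedDefault) ?_).trans_lt
    (EReal.coe_lt_top K)
  have htend : Tendsto (fun t : ℝ => polarPoint τ (2 * √(D * k) * γ (C / κ * |t|)) t) (𝓝[≠] 0)
      (𝓝[stolzRegion unitDisk (fun t : ℝ => √(D * γ (C * t))) τ] τ) := by
    refine tendsto_nhdsWithin_iff.2 ⟨tendsto_polarPoint hO hC' _ τ, ?_⟩
    have hsmall : ∀ᶠ t : ℝ in 𝓝[≠] 0, C / κ * |t| < a₀ := by
      have : Continuous fun t : ℝ => C / κ * |t| := by fun_prop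
      exact nhdsWithin_le_nhds ((this.tendsto 0).eventually_lt_const (by simpa using ha₀))
    filter_upwards [self_mem_nhdsWithin, hsmall,
      (tendsto_gauge hO hC' (2 * √(D * k))).eventually_lt_const one_pos] with t ht hta hρ1
    have ht0 : 0 < |t| := abs_pos.2 ht
    have hg := hpos (C / κ * |t|) (by positivity)
    set ρ := 2 * √(D * k) * γ (C / κ * |t|) with hρ
    have hρ0 : 0 < ρ := by positivity
    have hz := polarPoint_mem hτ hρ0 t
    have hz1 := mem_unitDisk.1 hz
    refine ⟨hz, |t|, ht0, ?_, ?_⟩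
    · rw [infDist_frontier_unitDisk hz1.le, norm_polarPoint hτ]
      refine le_trans ?_ (half_le_one_sub_exp_neg hρ0.le hρ1.le)
      have h1 := hγ (C / κ * |t|) ⟨by positivity, hta⟩
      have e1 : κ * (C / κ * |t|) = C * |t| := by field_simp
      rw [e1] at h1
      have e2 : ρ / 2 = √(D * k * γ (C / κ * |t|) ^ 2) := by
        rw [Real.sqrt_mul (by positivity), Real.sqrt_sq hg.le, hρ]
        ring
      rw [e2]
      refine Real.sqrt_le_sqrt ?_
      rw [mul_assoc]
      gcongr
    · rw [infDist_frontier_unitDisk hz1.le, dist_eq_norm, norm_polarPoint_sub_sq hτ]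
      refine Real.sqrt_le_iff.2 ⟨ht0.le, ?_⟩
      have h1 := Real.one_sub_sq_div_two_le_cos (x := t)
      have h2 : Real.exp (-ρ) ≤ 1 := Real.exp_le_one_iff.2 (by linarith)
      have h3 := Real.exp_pos (-ρ)
      have h4 : 0 ≤ 1 - Real.cos t := by linarith [Real.cos_le_one t]
      rw [sq_abs]
      nlinarith
  filter_upwards [htend.eventually hK] with t ht
  exact_mod_cast ht

/-! ### From the curve to regularity -/

/-- A conformal map of the disk onto the half plane with the pole `conj u`, `|u| = 1`. -/
theorem isConformalOnto_cayleyInv_mul {u : ℂ} (hu : ‖u‖ = 1) :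
    IsConformalOnto (fun v => cayleyInv Complex.I (u * v)) unitDisk upperPlane := by
  have hu0 : u ≠ 0 := by rintro rfl; simp at hu
  refine (isConformalOnto_cayleyInv (by simp)).comp ⟨by fun_prop, ?_⟩
  refine InvOn.bijOn (f' := fun v => u⁻¹ * v)
    ⟨fun v _ => inv_mul_cancel_left₀ hu0 v, fun v _ => mul_inv_cancel_left₀ hu0 v⟩
    (fun v hv => ?_) (fun v hv => ?_)
  · rw [mem_unitDisk] at hv ⊢
    simpa [hu] using hv
  · rw [mem_unitDisk] at hv ⊢
    simpa [hu] using hv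

theorem continuousAt_cayleyInv_mul {u v : ℂ} (h : u * v ≠ 1) :
    ContinuousAt (fun v => cayleyInv Complex.I (u * v)) v := by
  have : 1 - u * v ≠ 0 := sub_ne_zero.2 h.symm
  unfold cayleyInv
  fun_prop (disch := assumption)

theorem im_cayleyInv_I_mul {u v : ℂ} (hu : ‖u‖ = 1) (h : u * v ≠ 1) :
    (cayleyInv Complex.I (u * v)).im = (1 - ‖v‖ ^ 2) / ‖1 - u * v‖ ^ 2 := by
  rw [im_cayleyInv h, norm_mul, hu]
  simp

/-- The conformal map of the half plane onto the disk taking `0` to `τ` and `i` to `0`. -/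
noncomputable def cayleyTo (τ w : ℂ) : ℂ := -τ * cayleyAt Complex.I w

theorem isConformalOnto_cayleyTo {τ : ℂ} (hτ : ‖τ‖ = 1) :
    IsConformalOnto (cayleyTo τ) upperPlane unitDisk := by
  have hτ0 : -τ ≠ 0 := by rintro h; simp [neg_eq_zero.1 h] at hτ
  refine IsConformalOnto.comp (g := fun z => -τ * z) (V := unitDisk) ⟨by fun_prop, ?_⟩
    (isConformalOnto_cayleyAt (by simp))
  refine InvOn.bijOn (f' := fun v => (-τ)⁻¹ * v)
    ⟨fun v _ => inv_mul_cancel_left₀ hτ0 v, fun v _ => mul_inv_cancel_left₀ hτ0 v⟩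
    (fun v hv => ?_) (fun v hv => ?_)
  · rw [mem_unitDisk] at hv ⊢
    simpa [hτ] using hv
  · rw [mem_unitDisk] at hv ⊢
    simpa [hτ] using hv

theorem tendsto_cayleyTo (τ : ℂ) : Tendsto (cayleyTo τ) (𝓝[upperPlane] ((0 : ℝ) : ℂ)) (𝓝 τ) := by
  have h : ((0 : ℝ) : ℂ) - conj Complex.I ≠ 0 := by simp
  have hc : ContinuousAt (cayleyTo τ) ((0 : ℝ) : ℂ) := by
    unfold cayleyTo cayleyAt
    fun_prop (disch := assumption)
  have : cayleyTo τ ((0 : ℝ) : ℂ) = τ := by simp [cayleyTo, cayleyAt]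
  exact (this ▸ hc.tendsto).mono_left nhdsWithin_le_nhds

/-- The point of the half plane that `cayleyTo τ` maps to the point with radius `(1 - β) / (1 + β)`
on the radius of the disk ending at the image of `s`. -/
noncomputable def radialPoint (s β : ℝ) : ℂ := (s + β * Complex.I) / (1 - β * s * Complex.I)

theorem one_sub_mul_I_ne_zero (x : ℝ) : (1 : ℂ) - x * Complex.I ≠ 0 := by
  intro h
  have := congrArg Complex.re h
  simp at this

theorem radialPoint_denom_ne_zero (s β : ℝ) : (1 : ℂ) - β * s * Complex.I ≠ 0 := by
  have := one_sub_mul_I_ne_zero (β * s)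
  push_cast at this
  exact this

theorem im_radialPoint (s β : ℝ) :
    (radialPoint s β).im = β * (1 + s ^ 2) / (1 + (β * s) ^ 2) := by
  have hn : Complex.normSq (1 - β * s * Complex.I) = 1 + (β * s) ^ 2 := by
    rw [Complex.normSq_apply]; simp; ring
  rw [radialPoint, Complex.div_im, hn, ← sub_div]
  congr 1
  simp
  ring

theorem norm_radialPoint_sub_le {s β : ℝ} (hβ : 0 ≤ β) (hs : |s| ≤ 1) :
    ‖radialPoint s β - s‖ ≤ 2 * β := by
  have h := radialPoint_denom_ne_zero s β
  have e : radialPoint s β - s = β * (1 + s ^ 2) * Complex.I / (1 - β * s * Complex.I) := by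
    rw [radialPoint, eq_div_iff h, sub_mul, div_mul_cancel₀ _ h]
    ring
  have h1 : 1 ≤ ‖(1 : ℂ) - β * s * Complex.I‖ := by
    refine le_trans ?_ (Complex.abs_re_le_norm _)
    simp
  have h2 : s ^ 2 ≤ 1 := by rw [← sq_abs]; nlinarith [abs_nonneg s]
  have h3 : ‖(β * (1 + s ^ 2) * Complex.I : ℂ)‖ = β * (1 + s ^ 2) := by
    rw [norm_mul, Complex.norm_I, mul_one]
    have : (β * (1 + s ^ 2) : ℂ) = ((β * (1 + s ^ 2) : ℝ) : ℂ) := by push_cast; rfl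
    rw [this, Complex.norm_real, Real.norm_of_nonneg (by positivity)]
  rw [e, norm_div, h3]
  refine (div_le_self (by positivity) h1).trans ?_
  nlinarith

/-- Half-angle parametrization: s = tan(t/2) is the boundary coordinate in the half plane of the
angle t on the circle. -/
theorem exp_two_mul_arctan_mul_I (s : ℝ) :
    Complex.exp ((2 * Real.arctan s : ℝ) * Complex.I) = (Complex.I - s) / (Complex.I + s) := by
  have hpos : (0 : ℝ) < 1 + s ^ 2 := by positivity
  have hsq : (√(1 + s ^ 2) : ℂ) ^ 2 = 1 + (s : ℂ) ^ 2 := by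
    rw [← Complex.ofReal_pow, Real.sq_sqrt hpos.le]; push_cast; rfl
  have h0 : (√(1 + s ^ 2) : ℂ) ≠ 0 := by
    simpa using (Real.sqrt_pos.2 hpos).ne'
  have h1 : Complex.I + s ≠ 0 := by
    intro h
    have := congrArg Complex.im h
    simp at this
  have e : Complex.exp ((Real.arctan s : ℝ) * Complex.I) = (1 + s * Complex.I) / √(1 + s ^ 2) := by
    rw [Complex.exp_mul_I, ← Complex.ofReal_cos, ← Complex.ofReal_sin, Real.cos_arctan,
      Real.sin_arctan]
    push_cast
    field_simp
  have e2 : ((2 * Real.arctan s : ℝ) : ℂ) * Complex.I =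
      (Real.arctan s : ℝ) * Complex.I + (Real.arctan s : ℝ) * Complex.I := by
    push_cast; ring
  rw [e2, Complex.exp_add, e, ← sq, div_pow, hsq, div_eq_div_iff (by rw [← hsq]; positivity) h1]
  linear_combination ((s : ℂ) ^ 3 + s ^ 2 * Complex.I + 2 * s) * Complex.I_sq

/-- The quotient is tanh(ρ/2), the solution β of (1 - β)/(1 + β) = exp(-ρ). This transports the
curve in the disk to an explicit one in the half plane. -/
theorem cayleyTo_radialPoint (τ : ℂ) (s : ℝ) {ρ : ℝ} (hρ : 0 < ρ) :
    cayleyTo τ (radialPoint s ((1 - Real.exp (-ρ)) / (1 + Real.exp (-ρ)))) =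
      polarPoint τ ρ (2 * Real.arctan s) := by
  set r := Real.exp (-ρ) with hr
  have hr0 : 0 < r := Real.exp_pos _
  set β := (1 - r) / (1 + r) with hβ
  have hβr : (β : ℂ) * (1 + r) = 1 - r := by
    have : β * (1 + r) = 1 - r := by rw [hβ]; field_simp
    exact_mod_cast this
  have hβ1 : (1 : ℂ) + β ≠ 0 := by
    have hr1 : r < 1 := Real.exp_lt_one_iff.2 (by linarith)
    have : 0 < 1 + β := by
      have : 0 < β := div_pos (by linarith) (by linarith)
      linarith
    exact_mod_cast this.ne'
  have h1 : Complex.I + s ≠ 0 := by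
    intro h
    have := congrArg Complex.im h
    simp at this
  have hd := radialPoint_denom_ne_zero s β
  have e1 : radialPoint s β - Complex.I = -((1 - β) * (Complex.I - s)) / (1 - β * s * Complex.I) := by
    rw [radialPoint, eq_div_iff hd, sub_mul, div_mul_cancel₀ _ hd]
    linear_combination (β * s : ℂ) * Complex.I_sq
  have e2 : radialPoint s β + Complex.I = (1 + β) * (Complex.I + s) / (1 - β * s * Complex.I) := by
    rw [radialPoint, eq_div_iff hd, add_mul, div_mul_cancel₀ _ hd]
    linear_combination (-β * s : ℂ) * Complex.I_sq
  have e3 : cayleyAt Complex.I (radialPoint s β) = -(r * ((Complex.I - s) / (Complex.I + s))) := by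
    rw [cayleyAt, Complex.conj_I, sub_neg_eq_add, e1, e2, div_div_div_cancel_right₀ hd,
      ← mul_div_assoc, ← neg_div, div_eq_div_iff (mul_ne_zero hβ1 h1) h1]
    linear_combination (Complex.I - s) * (Complex.I + s) * hβr
  rw [cayleyTo, e3, polarPoint, Complex.exp_add, exp_two_mul_arctan_mul_I, hr]
  push_cast
  ring

/-- An upper bound of `Im f` at one point bounds the Nevanlinna measure. -/
theorem measure_le_of_im_le {f : ℂ → ℂ} {μ : Measure ℝ} {b : ℝ}
    {w : ℂ} (hw : 0 < w.im)
    (hrep : ENNReal.ofReal (f w).im = ENNReal.ofReal (b * w.im) +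
      ∫⁻ t : ℝ, ENNReal.ofReal (w.im / (Real.pi * ‖(t : ℂ) - w‖ ^ 2)) ∂μ)
    {Q ℓ : ℝ} (hℓ : 0 < ℓ) (hQ : (f w).im ≤ Q * w.im) {S : Set ℝ}
    (hS : MeasurableSet S) (hSℓ : ∀ t ∈ S, ‖(t : ℂ) - w‖ ≤ ℓ) :
    μ S ≤ ENNReal.ofReal (Q * Real.pi * ℓ ^ 2) := by
  have hpi := Real.pi_pos
  have h1 : ENNReal.ofReal (w.im / (Real.pi * ℓ ^ 2)) * μ S ≤ ENNReal.ofReal (Q * w.im) := by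
    calc _ = ∫⁻ t in S, ENNReal.ofReal (w.im / (Real.pi * ℓ ^ 2)) ∂μ := (setLIntegral_const _ _).symm
      _ ≤ ∫⁻ t in S, ENNReal.ofReal (w.im / (Real.pi * ‖(t : ℂ) - w‖ ^ 2)) ∂μ := by
        refine setLIntegral_mono' hS fun t ht => ENNReal.ofReal_le_ofReal ?_
        have := norm_ofReal_sub_pos hw t
        have := hSℓ t ht
        gcongr
      _ ≤ ∫⁻ t, ENNReal.ofReal (w.im / (Real.pi * ‖(t : ℂ) - w‖ ^ 2)) ∂μ :=
        setLIntegral_le_lintegral _ _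
      _ ≤ ENNReal.ofReal (f w).im := by rw [hrep]; exact le_add_self
      _ ≤ _ := ENNReal.ofReal_le_ofReal hQ
  have hc : 0 < w.im / (Real.pi * ℓ ^ 2) := by positivity
  calc μ S = ENNReal.ofReal (w.im / (Real.pi * ℓ ^ 2))⁻¹ *
        (ENNReal.ofReal (w.im / (Real.pi * ℓ ^ 2)) * μ S) := by
        rw [← mul_assoc, ← ENNReal.ofReal_mul (by positivity), inv_mul_cancel₀ hc.ne',
          ENNReal.ofReal_one, one_mul]
    _ ≤ ENNReal.ofReal (w.im / (Real.pi * ℓ ^ 2))⁻¹ * ENNReal.ofReal (Q * w.im) := by gcongr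
    _ = _ := by
      rw [← ENNReal.ofReal_mul (by positivity)]
      congr 1
      field_simp

theorem isNevanlinnaMeasure_zero {f : ℂ → ℂ} (h : ∀ w ∈ upperPlane, (f w).im = 0) :
    IsNevanlinnaMeasure f 0 := by
  refine ⟨inferInstance, fun g _ _ => ?_⟩
  simp only [integral_zero_measure]
  refine tendsto_const_nhds.congr' ?_
  filter_upwards [self_mem_nhdsWithin] with y hy
  have : ∀ x : ℝ, (f (x + y * Complex.I)).im = 0 := fun x => h _ (by
    simpa [upperPlane] using hy)
  simp [this]

/-- Taking the pole of ψ at -c makes the transformed function a real constant, whose Nevanlinna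
measure is zero. -/
theorem transformGammaRegularAt_of_const {γ : ℝ → ℝ} {φ : ℂ → ℂ} {c τ : ℂ} (hc : ‖c‖ = 1)
    (hφ : ∀ z ∈ unitDisk, φ z = c) (hτ : ‖τ‖ = 1) :
    TransformGammaRegularAt unitDisk unitDisk γ φ τ := by
  have hu : ‖-conj c‖ = 1 := by simpa using hc
  have huc : -conj c * c = -1 := by
    rw [neg_mul, ← Complex.normSq_eq_conj_mul_self, Complex.normSq_eq_norm_sq, hc]
    simp
  have hne : -conj c * c ≠ 1 := by rw [huc]; norm_num
  have hχ := isConformalOnto_cayleyTo hτ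
  refine ⟨fun v => cayleyInv Complex.I (-conj c * v), cayleyTo τ, 0, hχ, tendsto_cayleyTo τ,
    isConformalOnto_cayleyInv_mul hu, fun z hz => ?_, 0, isNevanlinnaMeasure_zero fun w hw => ?_,
    1, one_pos, 1, one_pos, by simp⟩
  · rw [hφ z hz]
    exact (continuousAt_cayleyInv_mul hne).continuousWithinAt
  · simp only [hφ _ (hχ.2.mapsTo hw)]
    rw [im_cayleyInv_I_mul hu hne, hc]
    simp

/-- If the Julia quotient is bounded on a family of points tending to `τ` then `φ` keeps away from
some point of the unit circle on this family. -/
theorem exists_pole {φ : ℂ → ℂ} (hφ : DifferentiableOn ℂ φ unitDisk)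
    (hm : MapsTo φ unitDisk unitDisk) {τ : ℂ} (hτ : ‖τ‖ = 1) {K : ℝ} (hK : 0 ≤ K) {S : Set ℂ}
    (hS : ∀ z ∈ S, z ∈ unitDisk ∧ 1 - ‖φ z‖ ≤ K * (1 - ‖z‖) ∧ 8 * K * ‖z - τ‖ ≤ 1)
    (hne : S.Nonempty) :
    ∃ u : ℂ, ‖u‖ = 1 ∧ ∀ z ∈ S, 1 ≤ ‖1 - u * φ z‖ := by
  obtain ⟨z', hz'⟩ := hne
  obtain ⟨hD', hJ', hn'⟩ := hS z' hz'
  have hz1' := mem_unitDisk.1 hD'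
  have hsq : ∀ {v : ℝ}, 0 ≤ v → v < 1 → 1 - v ≤ 1 - v ^ 2 ∧ 1 - v ^ 2 ≤ 2 * (1 - v) ∧
      0 < 1 - v ^ 2 := fun h0 h1 => ⟨by nlinarith, by nlinarith, by nlinarith⟩
  -- In Schwarz–Pick the bounded quotients at z and z' cancel the boundary distances, leaving 2K|1 -
  -- conj z' z| ≤ 2K(|z' - τ| + |z - τ|). The constant 8 in the hypothesis makes this at most 1/2,
  -- so all values of `φ` lie in one half plane around the direction of φ(z'); the pole is placed
  -- opposite.
  have key : ∀ z ∈ S, ‖1 - conj (φ z') * φ z‖ ≤ 1 / 2 := fun z hz => by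
    obtain ⟨hD, hJ, hn⟩ := hS z hz
    have hz1 := mem_unitDisk.1 hD
    have sp := schwarz_pick hφ hm hD hD'
    obtain ⟨a1, a2, a3⟩ := hsq (norm_nonneg z) hz1
    obtain ⟨b1, b2, b3⟩ := hsq (norm_nonneg z') hz1'
    obtain ⟨c1, c2, c3⟩ := hsq (norm_nonneg (φ z)) (mem_unitDisk.1 (hm hD))
    obtain ⟨d1, d2, d3⟩ := hsq (norm_nonneg (φ z')) (mem_unitDisk.1 (hm hD'))
    have h1 : 1 - ‖φ z‖ ^ 2 ≤ 2 * K * (1 - ‖z‖ ^ 2) := by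
      have : K * (1 - ‖z‖) ≤ K * (1 - ‖z‖ ^ 2) := by gcongr
      linarith
    have h2 : 1 - ‖φ z'‖ ^ 2 ≤ 2 * K * (1 - ‖z'‖ ^ 2) := by
      have : K * (1 - ‖z'‖) ≤ K * (1 - ‖z'‖ ^ 2) := by gcongr
      linarith
    have h3 : ‖1 - conj (φ z') * φ z‖ ^ 2 * ((1 - ‖z'‖ ^ 2) * (1 - ‖z‖ ^ 2)) ≤
        (2 * K * ‖1 - conj z' * z‖) ^ 2 * ((1 - ‖z'‖ ^ 2) * (1 - ‖z‖ ^ 2)) := by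
      refine sp.trans ?_
      calc _ ≤ ‖1 - conj z' * z‖ ^ 2 *
            ((2 * K * (1 - ‖z'‖ ^ 2)) * (2 * K * (1 - ‖z‖ ^ 2))) := by gcongr
        _ = _ := by ring
    have h4 := le_of_mul_le_mul_right h3 (by positivity)
    have h5 : ‖1 - conj (φ z') * φ z‖ ≤ 2 * K * ‖1 - conj z' * z‖ :=
      le_of_sq_le_sq h4 (by positivity)
    have h6 : ‖1 - conj z' * z‖ ≤ ‖z' - τ‖ + ‖z - τ‖ := by
      have e : 1 - conj z' * z = -(conj (z' - τ) * τ) - conj z' * (z - τ) := by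
        have : conj τ * τ = 1 := by
          rw [← Complex.normSq_eq_conj_mul_self, Complex.normSq_eq_norm_sq, hτ]
          simp
        rw [map_sub]
        linear_combination -this
      rw [e]
      refine (norm_sub_le _ _).trans ?_
      rw [norm_neg, norm_mul, norm_mul, hτ, RCLike.norm_conj, RCLike.norm_conj, mul_one]
      gcongr
      exact mul_le_of_le_one_left (norm_nonneg _) hz1'.le
    have h7 : 2 * K * ‖1 - conj z' * z‖ ≤ 2 * K * (‖z' - τ‖ + ‖z - τ‖) := by gcongr
    linarith
  have hre : ∀ z ∈ S, 1 / 2 ≤ (conj (φ z') * φ z).re := fun z hz => by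
    have h1 := (Complex.re_le_norm (1 - conj (φ z') * φ z)).trans (key z hz)
    rw [Complex.sub_re, Complex.one_re] at h1
    linarith
  have hp0 : φ z' ≠ 0 := by
    intro h
    have := hre z' hz'
    rw [h] at this
    norm_num at this
  have hp : 0 < ‖φ z'‖ := norm_pos_iff.2 hp0
  refine ⟨-(conj (φ z') / ‖φ z'‖), ?_, fun z hz => ?_⟩
  · rw [norm_neg, norm_div, RCLike.norm_conj, Complex.norm_real, norm_norm, div_self hp.ne']
  · refine le_trans ?_ (Complex.re_le_norm _)
    have e : 1 - -(conj (φ z') / ‖φ z'‖) * φ z = 1 + conj (φ z') * φ z / (‖φ z'‖ : ℝ) := by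
      ring
    rw [e, Complex.add_re, Complex.one_re, Complex.div_ofReal_re]
    have := hre z hz
    have : 0 ≤ (conj (φ z') * φ z).re / ‖φ z'‖ := by positivity
    linarith

theorem two_mul_arctan_le {x : ℝ} (hx : 0 ≤ x) : 2 * Real.arctan x ≤ 2 * x := by
  have := Real.le_tan (Real.arctan_nonneg.2 hx) (Real.arctan_lt_pi_div_two x)
  rw [Real.tan_arctan] at this
  linarith

theorem abs_two_mul_arctan (s : ℝ) : |2 * Real.arctan s| = 2 * Real.arctan |s| := by
  rw [abs_mul, abs_two]
  congr 1
  rcases le_total 0 s with h | h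
  · rw [abs_of_nonneg h, abs_of_nonneg (Real.arctan_nonneg.2 h)]
  · rw [abs_of_nonpos h, abs_of_nonpos (Real.arctan_le_zero.2 h), Real.arctan_neg]

theorem transformGammaRegularAt_of_curve_bound {γ : ℝ → ℝ} (hmono : MonotoneOn γ (Ici 0))
    (hnonneg : 0 ≤ γ 0) (hpos : ∀ t : ℝ, 0 < t → 0 < γ t)
    (hO : γ =O[𝓝[>] 0] fun t : ℝ => t ^ 2) {φ : ℂ → ℂ} (hφ : DifferentiableOn ℂ φ unitDisk)
    (hm : MapsTo φ unitDisk unitDisk) {τ : ℂ} (hτ : ‖τ‖ = 1) {C D K : ℝ} (hC : 0 < C)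
    (hD : 0 < D) (hK : 0 ≤ K)
    (h : ∀ᶠ t : ℝ in 𝓝[≠] 0,
      juliaQuotient unitDisk unitDisk φ (polarPoint τ (D * γ (C * |t|)) t) ≤ K) :
    TransformGammaRegularAt unitDisk unitDisk γ φ τ := by
  have hpi := Real.pi_pos
  set Z : ℝ → ℂ := fun t => polarPoint τ (D * γ (C * |t|)) t with hZ
  have hρpos : ∀ t : ℝ, t ≠ 0 → 0 < D * γ (C * |t|) := fun t ht =>
    mul_pos hD (hpos _ (mul_pos hC (abs_pos.2 ht)))
  have hZD : ∀ t : ℝ, t ≠ 0 → Z t ∈ unitDisk := fun t ht => polarPoint_mem hτ (hρpos t ht) t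
  -- the curve near `τ`
  have hnear : ∀ᶠ t : ℝ in 𝓝[≠] 0, 8 * K * ‖Z t - τ‖ ≤ 1 := by
    have h1 : Tendsto (fun t => 8 * K * ‖Z t - τ‖) (𝓝[≠] 0) (𝓝 0) := by
      have := ((tendsto_polarPoint hO hC D τ).sub_const τ).norm.const_mul (8 * K)
      simpa using this
    filter_upwards [h1.eventually_lt_const one_pos] with t ht using ht.le
  obtain ⟨δ₁, hδ₁, hδ⟩ := Metric.eventually_nhds_iff.1
    (eventually_nhdsWithin_iff.1 (h.and hnear))
  have hcurve : ∀ t : ℝ, t ≠ 0 → |t| < δ₁ →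
      Z t ∈ unitDisk ∧ 1 - ‖φ (Z t)‖ ≤ K * (1 - ‖Z t‖) ∧ 8 * K * ‖Z t - τ‖ ≤ 1 := fun t ht htδ => by
    obtain ⟨h1, h2⟩ := hδ (y := t) (by simpa using htδ) ht
    have hz := hZD t ht
    have hz1 := mem_unitDisk.1 hz
    refine ⟨hz, ?_, h2⟩
    rw [juliaQuotient_unitDisk hz (mem_unitDisk.1 (hm hz)).le,
      div_le_iff₀ (sub_pos.2 hz1)] at h1
    exact h1
  obtain ⟨u, hu, hpole⟩ := exists_pole hφ hm hτ hK (S := Z '' {t | t ≠ 0 ∧ |t| < δ₁})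
    (by rintro _ ⟨t, ht, rfl⟩; exact hcurve t ht.1 ht.2)
    ⟨Z (δ₁ / 2), δ₁ / 2, ⟨by positivity, by rw [abs_of_pos (by positivity)]; linarith⟩, rfl⟩
  have huv : ∀ v : ℂ, ‖v‖ < 1 → u * v ≠ 1 := fun v hv huv => by
    have := congrArg norm huv
    rw [norm_mul, hu, one_mul, norm_one] at this
    linarith
  have hψ := isConformalOnto_cayleyInv_mul hu
  have hχ := isConformalOnto_cayleyTo hτ
  set F : ℂ → ℂ := fun w => cayleyInv Complex.I (u * φ (cayleyTo τ w)) with hF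
  have hFd : DifferentiableOn ℂ F upperPlane :=
    hψ.1.comp (hφ.comp hχ.1 hχ.2.mapsTo) (hm.comp hχ.2.mapsTo)
  obtain ⟨b, μ, hb, hμ, -, hrep⟩ := exists_isNevanlinnaMeasure hFd fun w hw =>
    le_of_lt (hψ.2.mapsTo (hm (hχ.2.mapsTo hw)))
  suffices hreg : GammaRegularAt γ F 0 from
    ⟨fun v => cayleyInv Complex.I (u * v), cayleyTo τ, 0, hχ, tendsto_cayleyTo τ, hψ,
      fun z hz => (continuousAt_cayleyInv_mul
        (huv _ (mem_unitDisk.1 (hm hz)))).continuousWithinAt, hreg⟩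
  -- the curve in the half plane
  set ρ : ℝ → ℝ := fun x => D * γ (C * (2 * Real.arctan x)) with hρ
  set y : ℝ → ℝ := fun x => (1 - Real.exp (-ρ x)) / (1 + Real.exp (-ρ x)) with hy
  have hρ0 : ∀ x, 0 < x → 0 < ρ x := fun x hx => by
    have := Real.arctan_pos.2 hx
    exact mul_pos hD (hpos _ (by positivity))
  have hρm : ∀ x x', 0 < x → x ≤ x' → ρ x ≤ ρ x' := fun x x' hx hxx => by
    have h1 := Real.arctan_pos.2 hx
    have h2 := Real.arctan_mono hxx
    have : γ (C * (2 * Real.arctan x)) ≤ γ (C * (2 * Real.arctan x')) :=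
      hmono (mem_Ici.2 (by positivity)) (mem_Ici.2 (by have := h1.trans_le h2; positivity))
        (by gcongr)
    simp only [hρ]
    gcongr
  have hy0 : ∀ x, 0 < x → 0 < y x := fun x hx => by
    have : Real.exp (-ρ x) < 1 := Real.exp_lt_one_iff.2 (by linarith [hρ0 x hx])
    have := Real.exp_pos (-ρ x)
    exact div_pos (by linarith) (by linarith)
  have hyρ : ∀ x, 0 < x → y x ≤ ρ x := fun x hx => by
    have h1 := Real.exp_pos (-ρ x)
    have h2 := Real.add_one_le_exp (-ρ x)
    have h3 := hρ0 x hx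
    simp only [hy]
    rw [div_le_iff₀ (by linarith)]
    nlinarith
  have hym : MonotoneOn y (Ioi 0) := fun x hx x' _ hxx => by
    have h1 := Real.exp_pos (-ρ x')
    have h2 : Real.exp (-ρ x') ≤ Real.exp (-ρ x) :=
      Real.exp_le_exp.2 (neg_le_neg (hρm x x' hx hxx))
    simp only [hy]
    rw [div_le_div_iff₀ (by linarith) (by linarith)]
    nlinarith
  -- `y x ≤ x` near `0`
  obtain ⟨K₀, δ₀, hK₀, hδ₀, hgrow⟩ := kernel_growth hmono hnonneg hO hC
  -- The halves allow for 2 arctan x ≤ 2x. The third bound turns ρ(x) ≤ 4DK₀x² into y(x) ≤ x, and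
  -- the last keeps |s| ≤ 1 for `norm_radialPoint_sub_le`.
  set δ := min (min (δ₀ / 2) (δ₁ / 2)) (min (1 / (4 * D * K₀ + 1)) 1) with hδdef
  have hδ0 : 0 < δ := by positivity
  have hδa : δ ≤ δ₀ / 2 := (min_le_left _ _).trans (min_le_left _ _)
  have hδb : δ ≤ δ₁ / 2 := (min_le_left _ _).trans (min_le_right _ _)
  have hδc : δ ≤ 1 / (4 * D * K₀ + 1) := (min_le_right _ _).trans (min_le_left _ _)
  have hδd : δ ≤ 1 := (min_le_right _ _).trans (min_le_right _ _)
  have hys : ∀ x ∈ Ioo 0 δ, y x ≤ x := fun x hx => by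
    have ha0 := Real.arctan_pos.2 hx.1
    have ha := two_mul_arctan_le hx.1.le
    have h1 := hgrow (2 * Real.arctan x) (by positivity) (by linarith [hx.2])
    have h2 : x * (4 * D * K₀ + 1) ≤ 1 := by
      have := hx.2.le.trans hδc
      rwa [le_div_iff₀ (by positivity)] at this
    calc y x ≤ ρ x := hyρ x hx.1
      _ ≤ D * (K₀ * (2 * Real.arctan x) ^ 2) := by simp only [hρ]; gcongr
      _ ≤ D * (K₀ * (2 * x) ^ 2) := by gcongr
      _ = x * (x * (4 * D * K₀)) := by ring
      _ ≤ x * 1 := by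
        have := hx.1
        gcongr
        linarith
      _ = x := mul_one x
  -- the bound of `Im F` on the curve
  have himF : ∀ s : ℝ, 0 < |s| → |s| < δ → 0 < (radialPoint s (y |s|)).im ∧
      (F (radialPoint s (y |s|))).im ≤ 8 * K * (radialPoint s (y |s|)).im := fun s hs hsδ => by
    set w := radialPoint s (y |s|) with hw
    have hys0 := hy0 _ hs
    have hw0 : 0 < w.im := by
      rw [hw, im_radialPoint]; positivity
    refine ⟨hw0, ?_⟩
    set t := 2 * Real.arctan s with ht
    have ht0 : t ≠ 0 := by
      have : s ≠ 0 := abs_pos.1 hs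
      simpa [ht, Real.arctan_eq_zero_iff] using this
    have hta : |t| = 2 * Real.arctan |s| := abs_two_mul_arctan s
    have htδ : |t| < δ₁ := by
      have := two_mul_arctan_le hs.le
      rw [hta]
      linarith
    have hwz : cayleyTo τ w = Z t := by
      rw [hw, hZ]
      simp only [hta, hy]
      rw [cayleyTo_radialPoint τ s (hρ0 _ hs)]
    obtain ⟨hz, hJ, -⟩ := hcurve t ht0 htδ
    have hp := hpole (Z t) ⟨t, ⟨ht0, htδ⟩, rfl⟩
    have hφ1 := mem_unitDisk.1 (hm hz)
    have h1 : (F w).im ≤ 1 - ‖φ (Z t)‖ ^ 2 := by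
      simp only [hF]
      rw [hwz, im_cayleyInv_I_mul hu (huv _ hφ1)]
      refine div_le_self (by nlinarith [norm_nonneg (φ (Z t))]) ?_
      nlinarith
    have h2 : 1 - ‖φ (Z t)‖ ^ 2 ≤ 2 * (1 - ‖φ (Z t)‖) := by nlinarith [norm_nonneg (φ (Z t))]
    have h3 : 1 - ‖Z t‖ ≤ 4 * w.im := by
      have e1 : ‖Z t‖ = ‖cayleyAt Complex.I w‖ := by
        rw [← hwz, cayleyTo, norm_mul, norm_neg, hτ, one_mul]
      have e2 := one_sub_norm_cayleyAt (a := Complex.I) (by simp) hw0.le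
      have e3 := im_le_norm_sub_conj (a := Complex.I) hw0.le
      rw [Complex.I_im] at e2 e3
      rw [← e1] at e2
      have e4 : 4 * 1 * w.im / ‖w - conj Complex.I‖ ^ 2 ≤ 4 * 1 * w.im :=
        div_le_self (by positivity) (one_le_pow₀ e3)
      nlinarith [norm_nonneg (Z t), mem_unitDisk.1 hz]
    have h4 : K * (1 - ‖Z t‖) ≤ K * (4 * w.im) := by gcongr
    linarith
  -- The point of the curve lies within 2y of s, so the ball of radius y around s is within 3y of
  -- it; 72 = 8 · 3².
  have hball : ∀ s : ℝ, 0 < |s| → |s| < δ →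
      μ (Metric.closedBall s (y |s|)) ≤ ENNReal.ofReal (72 * K * Real.pi * y |s| ^ 2) :=
    fun s hs hsδ => by
    obtain ⟨hw0, him⟩ := himF s hs hsδ
    have hys0 := hy0 _ hs
    have := measure_le_of_im_le hw0 (hrep _ hw0) (ℓ := 3 * y |s|) (by positivity) him
      (S := Metric.closedBall s (y |s|)) measurableSet_closedBall fun t ht => by
        have h1 := norm_radialPoint_sub_le (s := s) hys0.le (hsδ.le.trans hδd)
        have h2 : ‖(t : ℂ) - s‖ ≤ y |s| := by
          rw [← Complex.ofReal_sub, Complex.norm_real, ← dist_eq_norm]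
          exact ht
        calc ‖(t : ℂ) - radialPoint s (y |s|)‖
            ≤ ‖(t : ℂ) - s‖ + ‖(s : ℂ) - radialPoint s (y |s|)‖ :=
              norm_sub_le_norm_sub_add_norm_sub _ _ _
          _ ≤ y |s| + 2 * y |s| := by rw [norm_sub_rev (s : ℂ)]; gcongr
          _ = _ := by ring
    refine this.trans (ENNReal.ofReal_le_ofReal (le_of_eq ?_))
    ring
  -- The dyadic blocks miss the origin. Curve points lie within 2y(s) + s ≤ 3s of it, so the atom is
  -- O(s²) for every small s.
  have hzero : μ {0} = 0 := by
    have hle : ∀ᶠ s : ℝ in 𝓝[>] 0, μ {0} ≤ ENNReal.ofReal (8 * K * Real.pi * (3 * s) ^ 2) := by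
      filter_upwards [Ioo_mem_nhdsGT hδ0] with s hs
      have hs1 : |s| = s := abs_of_pos hs.1
      obtain ⟨hw0, him⟩ := himF s (by rw [hs1]; exact hs.1) (by rw [hs1]; exact hs.2)
      rw [hs1] at hw0 him
      refine measure_le_of_im_le hw0 (hrep _ hw0) (by linarith [hs.1]) him
        (measurableSet_singleton 0) fun t ht => ?_
      obtain rfl : t = 0 := ht
      have h1 := norm_radialPoint_sub_le (s := s) (hy0 s hs.1).le
        (by rw [hs1]; exact hs.2.le.trans hδd)
      have h2 := hys s hs
      have h3 := norm_add_le (radialPoint s (y s) - s) (s : ℂ)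
      rw [sub_add_cancel, Complex.norm_real, Real.norm_eq_abs, hs1] at h3
      rw [Complex.ofReal_zero, zero_sub, norm_neg]
      linarith
    have hlim : Tendsto (fun s : ℝ => ENNReal.ofReal (8 * K * Real.pi * (3 * s) ^ 2)) (𝓝[>] 0)
        (𝓝 0) := by
      have : Continuous fun s : ℝ => ENNReal.ofReal (8 * K * Real.pi * (3 * s) ^ 2) :=
        ENNReal.continuous_ofReal.comp (by fun_prop)
      simpa using (this.tendsto 0).mono_left nhdsWithin_le_nhds
    exact le_antisymm (ge_of_tendsto hlim hle) zero_le
  obtain ⟨δ', hδ', hint⟩ := exists_lintegral_Ioo_lt_top (K := 72 * K * Real.pi) hδ0 hym hy0 hys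
    (by positivity) hD.le hzero hball
    -- The constant 4C comes from 2 arctan(2|t|) ≤ 4|t|, the inner 2 being the doubled argument in
    -- the dyadic estimate.
    (g := fun t => (ENNReal.ofReal (γ (4 * C * |t|)))⁻¹) (fun t ht => by
      have ht0 := abs_pos.2 ht
      have hg := hpos (4 * C * |t|) (by positivity)
      have h1 := hy0 (2 * |t|) (by positivity)
      rw [← ENNReal.ofReal_inv_of_pos hg]
      refine ENNReal.ofReal_le_ofReal ?_
      rw [← one_div, div_le_div_iff₀ hg h1, one_mul]
      refine (hyρ _ (by positivity)).trans ?_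
      have h2 := two_mul_arctan_le (x := 2 * |t|) (by positivity)
      have h3 := Real.arctan_pos.2 (show 0 < 2 * |t| by positivity)
      have h4 : γ (C * (2 * Real.arctan (2 * |t|))) ≤ γ (4 * C * |t|) :=
        hmono (mem_Ici.2 (by positivity)) (mem_Ici.2 (by positivity)) (by nlinarith)
      simp only [hρ]
      gcongr)
  refine ⟨μ, hμ, 4 * C, by positivity, δ', hδ', ?_⟩
  simpa using hint

theorem mainTheorem5 (γ : ℝ → ℝ) (hmono : MonotoneOn γ (Ici 0))
    (hnonneg : 0 ≤ γ 0) (hpos : ∀ t : ℝ, 0 < t → 0 < γ t)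
    (hO : γ =O[𝓝[>] 0] fun t : ℝ => t ^ 2)
    (haug : IsAugury γ hmono (fun t : ℝ => √(γ t)))
    (φ : ℂ → ℂ) (hφ : DifferentiableOn ℂ φ unitDisk)
    (hφmaps : MapsTo φ unitDisk (closure unitDisk))
    (τ : ℂ) (hτ : τ ∈ frontier unitDisk) :
    List.TFAE [
      TransformGammaRegularAt unitDisk unitDisk γ φ τ,
      ∃ C D : ℝ, 0 < C ∧ 0 < D ∧ ∃ K : ℝ,
        ∀ᶠ z in 𝓝[stolzRegion unitDisk (fun t : ℝ => √(D * γ (C * t))) τ] τ,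
          juliaQuotient unitDisk unitDisk φ z ≤ K,
      ∃ C D : ℝ, 0 < C ∧ 0 < D ∧
        limsup (fun t : ℝ => ((juliaQuotient unitDisk unitDisk φ
          (τ * Complex.exp (-((D * γ (C * |t|) : ℝ) : ℂ) + t * Complex.I)) : ℝ) : EReal))
          (𝓝[≠] 0) < ⊤] := by
  have hτ1 : ‖τ‖ = 1 := by simpa [frontier_unitDisk] using hτ
  tfae_have 1 → 2 := exists_stolz_bound_of_transformGammaRegularAt hmono hnonneg hO hφ hφmaps
  tfae_have 2 → 3 := limsup_lt_top_of_stolz_bound hmono hpos hO haug _ hτ1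
  tfae_have 3 → 1 := by
    rintro ⟨C, D, hC, hD, hlim⟩
    rcases mapsTo_unitDisk_or_const hφ hφmaps with hm | ⟨c, hc, hφc⟩
    · obtain ⟨K, hK, -⟩ := EReal.lt_iff_exists_real_btwn.1 hlim
      refine transformGammaRegularAt_of_curve_bound hmono hnonneg hpos hO hφ hm hτ1 hC hD
        (le_max_right K 0) ?_
      filter_upwards [eventually_lt_of_limsup_lt hK] with t ht
      exact (EReal.coe_lt_coe_iff.1 ht).le.trans (le_max_left _ _)
    · exact transformGammaRegularAt_of_const hc hφc hτ1
  tfae_finish
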